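/- Let $\Omega\subset\mathbb R^3$ be a non-empty bounded open set with boundary $\Gamma=\partial\Omega$ of class $C^4$, and let $\Omega'=\mathbb R^3\setminus\overline\Omega$. For $\delta>0$ put $\mathcal V_\delta=\{x\in\Omega' : \operatorname{dist}(x,\Gamma)<\delta\}$. For $v\in H^1(\Omega;\mathbb C^4)$ and $m,\delta>0$ let $$V_v=\{u\in H^1(\Omega';\mathbb C^4) : u=v\text{ on }\Gamma\},\qquad \Lambda_m(v)=\inf_{u\in V_v}\left(\|\nabla u\|_{L^2(\Omega')}^2+m^2\|u\|_{L^2(\Omega')}^2\right),$$ $$V_{v,\delta}=\{u\in H^1(\mathcal V_\delta;\mathbb C^4) : u=v\text{ on }\Gamma,\ u(x)=0\text{ if }\operatorname{dist}(x,\Gamma)=\delta\},\qquad \Lambda_{m,\delta}(v)=\inf_{u\in V_{v,\delta}}\left(\|\nabla u\|_{L^2(\mathcal V_\delta)}^2+m^2\|u\|_{L^2(\mathcal V_\delta)}^2\right),$$ where the equality $u=v$ on $\Gamma$ is understood in the sense of traces, and $u(x)=0$ if $\operatorname{dist}(x,\Gamma)=\delta$ means that $u$ is a limit in $H^1(\mathcal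 V_\delta;\mathbb C^4)$ of functions in that space each of which vanishes on $\{x\in\mathcal V_\delta:\operatorname{dist}(x,\Gamma)>\delta'\}$ for some $\delta'<\delta$. A function $u_m\in V_v$ is called a minimizer associated with $\Lambda_m(v)$ if it minimizes $u\mapsto\|\nabla u\|_{L^2(\Omega')}^2+m^2\|u\|_{L^2(\Omega')}^2$ over $V_v$. **Proposition.** Let $\gamma\in(0,1)$. There exist $\delta_0>0$ and $C_1,C_2>0$ (depending only on $\Omega$ and $\gamma$) such that, for all $\delta\in(0,\delta_0)$, all $m>0$ and all $v\in H^1(\Omega;\mathbb C^4)$, every minimizer $u_m$ associated with $\Lambda_m(v)$ satisfies $$\left\|e^{m\gamma\operatorname{dist}(\cdot,\Gamma)}u_m\right\|^2_{L^2(\Omega')}\le C_1\,\|u_m\|^2_{L^2(\Omega')},$$ and $$\left(1-C_2\,m^{-1}e^{-\gamma\sqrt m}\right)\Lambda_{m,m^{-1/2}}(v)\le\Lambda_m(v)\le\Lambda_{m,\delta}(v).$$ -/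

import Mathlib

open MeasureTheory Filter Topology

noncomputable section

namespace MITBag

/-- Physical space `ℝ³` with its Euclidean norm. -/
abbrev Space : Type := EuclideanSpace ℝ (Fin 3)

/-- The space of spinors `ℂ⁴` with its Hermitian norm. -/
abbrev Spinor : Type := EuclideanSpace ℂ (Fin 4)

/-- `Ω` has a boundary of class `C⁴`: near each boundary point, `Ω` is the sublevel set of a `C⁴`
function without critical points. -/
def HasC4Boundary (Ω : Set Space) : Prop :=
  ∀ x ∈ frontier Ω, ∃ (W : Set Space) (ρ : Space → ℝ), IsOpen W ∧ x ∈ W ∧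
    ContDiffOn ℝ 4 ρ W ∧ (∀ y ∈ W, fderiv ℝ ρ y ≠ 0) ∧ Ω ∩ W = {y ∈ W | ρ y < 0}

/-- The exterior domain `Ω'`, the complement of the closure of `Ω`. -/
def exterior (Ω : Set Space) : Set Space := (closure Ω)ᶜ

/-- The tubular neighbourhood `𝒱_δ = {x ∈ Ω' : dist(x, Γ) < δ}` of `Γ = ∂Ω` in `Ω'`. -/
def tube (Ω : Set Space) (δ : ℝ) : Set Space :=
  {x ∈ exterior Ω | Metric.infDist x (frontier Ω) < δ}

/-- `g` is the `j`-th partial derivative of `u` on `U` in the sense of distributions. -/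
def IsWeakPartial (U : Set Space) (j : Fin 3) (u g : Space → Spinor) : Prop :=
  ∀ φ : Space → ℝ, ContDiff ℝ ((⊤ : ℕ∞) : WithTop ℕ∞) φ → HasCompactSupport φ → tsupport φ ⊆ U →
    ∫ x in U, (fderiv ℝ φ x (EuclideanSpace.single j (1 : ℝ))) • u x = -∫ x in U, φ x • g x

/-- `u` has a `j`-th weak partial derivative on `U` which is square integrable. -/
def HasL2Partial (U : Set Space) (j : Fin 3) (u : Space → Spinor) : Prop :=
  ∃ g : Space → Spinor, MemLp g 2 (volume.restrict U) ∧ IsWeakPartial U j u g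

/-- The Sobolev space `H¹(U; ℂ⁴)`. Functions are defined on all of `ℝ³`, but only their values
on `U` matter. -/
def MemH1 (U : Set Space) (u : Space → Spinor) : Prop :=
  MemLp u 2 (volume.restrict U) ∧ ∀ j : Fin 3, HasL2Partial U j u

open Classical in
/-- The (almost everywhere unique) square integrable weak partial derivative `∂ⱼu` on the open set
`U`, and `0` if there is none. -/
def weakPartial (U : Set Space) (j : Fin 3) (u : Space → Spinor) : Space → Spinor :=
  if h : HasL2Partial U j u then h.choose else 0

/-- Convergence `w n → u` in `H¹(U; ℂ⁴)` (for functions in that space). -/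
def TendstoH1 (U : Set Space) (w : ℕ → Space → Spinor) (u : Space → Spinor) : Prop :=
  Tendsto (fun n => eLpNorm (w n - u) 2 (volume.restrict U)) atTop (𝓝 0) ∧
  ∀ j : Fin 3, Tendsto
    (fun n => eLpNorm (weakPartial U j (w n) - weakPartial U j u) 2 (volume.restrict U)) atTop (𝓝 0)

/-- `u ∈ H¹(U; ℂ⁴)` has the trace `g ∈ L²(Γ; ℂ⁴)` on the boundary part `Γ ⊆ ∂U`, where `Γ` carries
the surface measure (the two-dimensional Hausdorff measure). The trace of an `H¹` function that is
continuous up to `Γ` near `Γ` is its restriction to `Γ`, and the trace map is extended from these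
functions by continuity from `H¹(U)` to `L²(Γ)`. -/
def HasTrace (U Γ : Set Space) (u g : Space → Spinor) : Prop :=
  MemLp g 2 ((Measure.euclideanHausdorffMeasure 2).restrict Γ) ∧
  ∃ φ : ℕ → Space → Spinor,
    (∀ n, MemH1 U (φ n) ∧
      ∃ W : Set Space, IsOpen W ∧ Γ ⊆ W ∧ ContinuousOn (φ n) ((U ∪ Γ) ∩ W)) ∧
    TendstoH1 U φ u ∧
    Tendsto (fun n => eLpNorm (φ n - g) 2 ((Measure.euclideanHausdorffMeasure 2).restrict Γ))
      atTop (𝓝 0)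

/-- `u = v` on `Γ`, in the sense of traces, for `u ∈ H¹(U)` and `v ∈ H¹(Ω)`. -/
def SameTrace (U Ω Γ : Set Space) (u v : Space → Spinor) : Prop :=
  ∃ g : Space → Spinor, HasTrace U Γ u g ∧ HasTrace Ω Γ v g

/-- `u(x) = 0` if `dist(x, Γ) = δ`, for `u ∈ H¹(𝒱_δ)`: `u` belongs to the closure in `H¹(𝒱_δ)` of
the functions that vanish near that part of the boundary of `𝒱_δ`. -/
def VanishesOnOuterBoundary (Ω : Set Space) (δ : ℝ) (u : Space → Spinor) : Prop :=
  ∃ w : ℕ → Space → Spinor,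
    (∀ n, MemH1 (tube Ω δ) (w n) ∧
      ∃ δ' < δ, ∀ x ∈ tube Ω δ, δ' < Metric.infDist x (frontier Ω) → w n x = 0) ∧
    TendstoH1 (tube Ω δ) w u

/-- `‖∇u‖²_{L²(U)} + m²‖u‖²_{L²(U)}`. -/
def energy (U : Set Space) (m : ℝ) (u : Space → Spinor) : ℝ :=
  (∑ j : Fin 3, ∫ x in U, ‖weakPartial U j u x‖ ^ 2) + m ^ 2 * ∫ x in U, ‖u x‖ ^ 2

/-- The set `V_v` of the functions in `H¹(Ω'; ℂ⁴)` that are equal to `v` on `Γ = ∂Ω`. -/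
def admissible (Ω : Set Space) (v : Space → Spinor) : Set (Space → Spinor) :=
  {u | MemH1 (exterior Ω) u ∧ SameTrace (exterior Ω) Ω (frontier Ω) u v}

/-- The set `V_{v,δ}` of the functions in `H¹(𝒱_δ; ℂ⁴)` that are equal to `v` on `Γ = ∂Ω` and
vanish where `dist(x, Γ) = δ`. -/
def admissibleTube (Ω : Set Space) (δ : ℝ) (v : Space → Spinor) : Set (Space → Spinor) :=
  {u | MemH1 (tube Ω δ) u ∧ SameTrace (tube Ω δ) Ω (frontier Ω) u v ∧
    VanishesOnOuterBoundary Ω δ u}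

/-- `Λ_m(v)`, the infimum of the energy on `Ω'` over `V_v`. -/
def Lam (Ω : Set Space) (m : ℝ) (v : Space → Spinor) : ℝ :=
  sInf (energy (exterior Ω) m '' admissible Ω v)

/-- `Λ_{m,δ}(v)`, the infimum of the energy on `𝒱_δ` over `V_{v,δ}`. -/
def LamTube (Ω : Set Space) (m δ : ℝ) (v : Space → Spinor) : ℝ :=
  sInf (energy (tube Ω δ) m '' admissibleTube Ω δ v)

/-- `u` is the minimizer `u_m(v)` of the energy on `Ω'` over `V_v` (it is unique as an element of
`H¹(Ω')`). -/
def IsMinimizer (Ω : Set Space) (m : ℝ) (v u : Space → Spinor) : Prop :=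
  u ∈ admissible Ω v ∧ ∀ w ∈ admissible Ω v, energy (exterior Ω) m u ≤ energy (exterior Ω) m w

end MITBag

end

/-! The upper bound holds because extension by zero maps `V_{v,δ}` into `V_v` without changing the
energy (`indicator_mem_admissible`, `energy_indicator`). The rest is an Agmon estimate. Write `d`
for the distance to `Γ`. For real Lipschitz `η`, the IMS formula `energy_smul_eq` splits the energy
of `ηu` into the energy form at `(u, η²u)` plus `∫ |∇η|²|u|²`. If `η` vanishes on `Γ`, the form term
is a first variation, hence zero at a minimizer. With `η = q - 1` and `q = exp(mγ min(d, R))`, the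
inequality `|∇d| ≤ 1` gives `∫ η²|u|² ≤ γ² ∫ q²|u|²`, and `q² ≤ η²/γ + 1/(1-γ)` then yields `∫
q²|u|² ≤ (1-γ)⁻² ∫ |u|²` for every `R`. Monotone convergence in `R` gives the decay.

For the lower bound, `u` is cut off inside the tube of width `δ = m^(-1/2)`. The cutoff gradient has
square at most `16m` and lives where `d ≥ δ/2`, so `q² ≥ exp(γ√m)` there. By the Agmon estimate and
`m²‖u‖² ≤ energy`, the cost is a fraction `16(1-γ)⁻² m⁻¹ exp(-γ√m)` of the energy.

Existence of minimizers is never needed: everything is proved for minimizers up to `ε`, with an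
error of order `√ε` (`abs_energyForm_le`, `exists_agmon`, `exists_LamTube_le`), and `ε → 0` at the
end.

Since `d` is only Lipschitz, the preparatory work is a calculus of weak derivatives with Lipschitz
multipliers. -/

noncomputable section

namespace MITBag

/-! ### Lipschitz functions and their mollification. -/

/-- The `j`-th classical partial derivative of a real function. -/
def partialDeriv (j : Fin 3) (f : Space → ℝ) (x : Space) : ℝ :=
  fderiv ℝ f x (EuclideanSpace.single j (1 : ℝ))

lemma abs_partialDeriv_le {K : NNReal} {f : Space → ℝ} (hf : LipschitzWith K f) (j : Fin 3)
    (x : Space) : |partialDeriv j f x| ≤ K := by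
  have h := (fderiv ℝ f x).le_opNorm (EuclideanSpace.single j (1 : ℝ))
  have h2 := norm_fderiv_le_of_lipschitz ℝ hf (x₀ := x)
  simp only [PiLp.norm_single, norm_one, mul_one, Real.norm_eq_abs] at h
  exact h.trans h2

lemma measurable_partialDeriv (j : Fin 3) (f : Space → ℝ) : Measurable (partialDeriv j f) :=
  measurable_fderiv_apply_const ℝ f _

/-- By Riesz representation the partial derivatives are the coordinates of the gradient. Bounding
each of them separately would lose a factor 3, which the Agmon estimate cannot afford for `γ` close
to 1. -/
lemma sum_sq_partialDeriv_le (f : Space → ℝ) (x : Space) :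
    ∑ j, partialDeriv j f x ^ 2 ≤ ‖fderiv ℝ f x‖ ^ 2 := by
  set L := fderiv ℝ f x with hL
  obtain ⟨w, hw⟩ := (InnerProductSpace.toDual ℝ Space).surjective L
  have h1 : ‖w‖ = ‖L‖ := by rw [← hw]; simp
  have h2 : ∀ j, partialDeriv j f x = w j := by
    intro j
    have : partialDeriv j f x = L (EuclideanSpace.single j (1 : ℝ)) := rfl
    rw [this, ← hw]
    simp [InnerProductSpace.toDual_apply_apply, EuclideanSpace.inner_single_right]
  rw [← h1, EuclideanSpace.norm_sq_eq]
  simp [h2]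

/-- The mollification of a Lipschitz function is differentiable along coordinate directions, with
derivative the mollification of the derivative. -/
lemma hasDerivAt_convolution_of_lipschitz {K : NNReal} {f : Space → ℝ} (hf : LipschitzWith K f)
    (ρ : ContDiffBump (0 : Space)) (j : Fin 3) (x : Space) :
    HasDerivAt (fun s : ℝ => convolution (ρ.normed volume) f (ContinuousLinearMap.lsmul ℝ ℝ)
        volume (x + s • EuclideanSpace.single j (1 : ℝ)))
      (convolution (ρ.normed volume) (partialDeriv j f) (ContinuousLinearMap.lsmul ℝ ℝ)
        volume x) 0 := by
  set e : Space := EuclideanSpace.single j (1 : ℝ) with he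
  have hen : ‖e‖ = 1 := by simp [he]
  have hcont : ∀ s : ℝ, Continuous fun t => ρ.normed volume t * f (x + s • e - t) := fun s =>
    ρ.continuous_normed.mul (hf.continuous.comp (by fun_prop))
  have hρint : Integrable (ρ.normed volume : Space → ℝ) := ρ.integrable_normed
  -- Rademacher's theorem, transported by the measure-preserving map `t ↦ x - t`. Differentiation
  -- under the integral needs the derivative at `s = 0` only for almost every `t`.
  have hae : ∀ᵐ t : Space, DifferentiableAt ℝ f (x - t) :=
    (Measure.measurePreserving_sub_left volume x).quasiMeasurePreserving.ae
      (hf.ae_differentiableAt (μ := volume))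
  have key := (hasDerivAt_integral_of_dominated_loc_of_lip (μ := (volume : Measure Space))
    (F := fun (s : ℝ) t => ρ.normed volume t * f (x + s • e - t))
    (F' := fun t => ρ.normed volume t * partialDeriv j f (x - t)) (x₀ := (0 : ℝ))
    (s := Set.univ) (bound := fun t => ρ.normed volume t * K) univ_mem
    (Eventually.of_forall fun s => (hcont s).aestronglyMeasurable)
    ((hcont 0).integrable_of_hasCompactSupport ρ.hasCompactSupport_normed.mul_right)
    ((ρ.continuous_normed.measurable.mul
      ((measurable_partialDeriv j f).comp (measurable_const.sub measurable_id))).aestronglyMeasurable)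
    ?_ (hρint.mul_const _) ?_).2
  · simpa [convolution_def] using key
  · refine Eventually.of_forall fun t => ?_
    refine LipschitzOnWith.of_dist_le_mul fun a _ b _ => ?_
    have h0 := ρ.nonneg_normed (μ := volume) t
    have h1 := hf.dist_le_mul (x + a • e - t) (x + b • e - t)
    rw [Real.dist_eq, ← mul_sub, abs_mul, abs_of_nonneg h0, Real.coe_nnabs,
      abs_of_nonneg (a := _ * (K : ℝ)) (mul_nonneg h0 K.2), mul_assoc]
    refine mul_le_mul_of_nonneg_left ?_ h0
    have h2 : dist (x + a • e - t) (x + b • e - t) = dist a b := by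
      rw [dist_eq_norm, dist_eq_norm,
        show x + a • e - t - (x + b • e - t) = (a - b) • e by rw [sub_smul]; abel, norm_smul, hen,
        mul_one]
    rw [h2] at h1
    exact h1
  · filter_upwards [hae] with t ht
    refine HasDerivAt.const_mul _ ?_
    have h3 : HasDerivAt (fun s : ℝ => x + s • e - t) e 0 := by
      simpa using (((hasDerivAt_id (0 : ℝ)).smul_const e).const_add x).sub_const t
    have h4 : HasFDerivAt f (fderiv ℝ f (x - t)) (x + (0 : ℝ) • e - t) := by
      simpa using ht.hasFDerivAt
    exact h4.comp_hasDerivAt (0 : ℝ) h3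

lemma abs_convolution_normed_le {f : Space → ℝ} {M : ℝ} (hM : ∀ x, |f x| ≤ M)
    (ρ : ContDiffBump (0 : Space)) (x : Space) :
    |convolution (ρ.normed volume) f (ContinuousLinearMap.lsmul ℝ ℝ) volume x| ≤ M := by
  rw [convolution_def, ← Real.norm_eq_abs]
  calc ‖∫ t, (ContinuousLinearMap.lsmul ℝ ℝ) (ρ.normed volume t) (f (x - t))‖
      ≤ ∫ t, ρ.normed volume t * M := by
        refine norm_integral_le_of_norm_le (ρ.integrable_normed.mul_const _)
          (Eventually.of_forall fun t => ?_)
        have h0 := ρ.nonneg_normed (μ := volume) t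
        simp only [ContinuousLinearMap.lsmul_apply, smul_eq_mul, Real.norm_eq_abs, abs_mul,
          abs_of_nonneg h0]
        exact mul_le_mul_of_nonneg_left (hM _) h0
    _ = M := by rw [integral_mul_const, ρ.integral_normed, one_mul]

/-- Lipschitz functions with compact support in `U` are limits of test functions on `U`. -/
lemma exists_smooth_approx {U : Set Space} (hU : IsOpen U) {K : NNReal} {f : Space → ℝ}
    (hf : LipschitzWith K f) (hfc : HasCompactSupport f) (hfU : tsupport f ⊆ U) :
    ∃ (F : ℕ → Space → ℝ) (S : Set Space) (M : ℝ), IsCompact S ∧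
      (∀ n, ContDiff ℝ ((⊤ : ℕ∞) : WithTop ℕ∞) (F n) ∧ HasCompactSupport (F n) ∧
        tsupport (F n) ⊆ U ∧ tsupport (F n) ⊆ S ∧ (∀ x, |F n x| ≤ M) ∧
        ∀ j x, |partialDeriv j (F n) x| ≤ K) ∧
      (∀ x, Tendsto (fun n => F n x) atTop (𝓝 (f x))) ∧
      ∀ j, ∀ᵐ x, Tendsto (fun n => partialDeriv j (F n) x) atTop (𝓝 (partialDeriv j f x)) := by
  obtain ⟨r, hr, hrU⟩ := hfc.isCompact.exists_cthickening_subset_open hU hfU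
  obtain ⟨M, hM⟩ := hfc.exists_bound_of_continuous hf.continuous
  set ρ : ℕ → ContDiffBump (0 : Space) := fun n =>
    ⟨r / (n + 1) / 2, r / (n + 1), by positivity, half_lt_self (by positivity)⟩ with hρ
  have hrOut : Tendsto (fun n => (ρ n).rOut) atTop (𝓝 0) := by
    have := tendsto_one_div_add_atTop_nhds_zero_nat (𝕜 := ℝ)
    simpa [hρ, div_eq_mul_inv] using this.const_mul r
  have hloc : LocallyIntegrable f (volume : Measure Space) := hf.continuous.locallyIntegrable
  set F : ℕ → Space → ℝ := fun n => convolution ((ρ n).normed volume) f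
    (ContinuousLinearMap.lsmul ℝ ℝ) volume with hF
  have hsm : ∀ n, ContDiff ℝ ((⊤ : ℕ∞) : WithTop ℕ∞) (F n) := fun n =>
    (ρ n).hasCompactSupport_normed.contDiff_convolution_left _ (ρ n).contDiff_normed hloc
  have hpd : ∀ n j x, partialDeriv j (F n) x = convolution ((ρ n).normed volume)
      (partialDeriv j f) (ContinuousLinearMap.lsmul ℝ ℝ) volume x := by
    intro n j x
    have h1 := hasDerivAt_convolution_of_lipschitz hf (ρ n) j x
    have h2 : HasDerivAt (fun s : ℝ => x + s • EuclideanSpace.single j (1 : ℝ))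
        (EuclideanSpace.single j (1 : ℝ) : Space) 0 := by
      simpa using ((hasDerivAt_id (0 : ℝ)).smul_const
        (EuclideanSpace.single j (1 : ℝ) : Space)).const_add x
    have h3 : HasFDerivAt (F n) (fderiv ℝ (F n) x)
        (x + (0 : ℝ) • (EuclideanSpace.single j (1 : ℝ) : Space)) := by
      simpa using ((hsm n).differentiable (by simp) x).hasFDerivAt
    have h4 := h3.comp_hasDerivAt (0 : ℝ) h2
    exact h4.unique h1
  have hts : ∀ n, tsupport (F n) ⊆ Metric.cthickening r (tsupport f) := by
    intro n
    refine closure_minimal ?_ Metric.isClosed_cthickening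
    refine (support_convolution_subset _).trans ?_
    rintro _ ⟨a, ha, b, hb, rfl⟩
    rw [(ρ n).support_normed_eq] at ha
    refine Metric.mem_cthickening_of_dist_le _ b _ _ (subset_tsupport f hb) ?_
    have h1 : ‖a‖ < r / (n + 1) := by simpa [hρ] using ha
    have h2 : r / ((n : ℝ) + 1) ≤ r := div_le_self hr.le (by linarith [n.cast_nonneg (α := ℝ)])
    simp only [dist_eq_norm, add_sub_cancel_right]
    linarith
  refine ⟨F, Metric.cthickening r (tsupport f), M, hfc.isCompact.cthickening, fun n =>
    ⟨hsm n, ?_, (hts n).trans hrU, hts n, abs_convolution_normed_le hM _, fun j x => ?_⟩, ?_, ?_⟩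
  · exact hfc.isCompact.cthickening.of_isClosed_subset (isClosed_tsupport _) (hts n)
  · rw [hpd]
    exact abs_convolution_normed_le (abs_partialDeriv_le hf j) _ x
  · exact fun x => ContDiffBump.convolution_tendsto_right_of_continuous hrOut hf.continuous x
  · intro j
    have hl : LocallyIntegrable (partialDeriv j f) (volume : Measure Space) := by
      refine (locallyIntegrable_const (K : ℝ)).mono
        (measurable_partialDeriv j f).aestronglyMeasurable (Eventually.of_forall fun x => ?_)
      simpa using abs_partialDeriv_le hf j x
    -- Convergence at Lebesgue points needs a bounded ratio of outer to inner radius; the bumps were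
    -- chosen with ratio exactly 2.
    have := ContDiffBump.ae_convolution_tendsto_right_of_locallyIntegrable (K := 2) hrOut
      (Eventually.of_forall fun n => by simp only [hρ]; linarith) hl
    filter_upwards [this] with x hx
    simpa only [hpd] using hx

/-! ### Pairings of square integrable functions and calculus of weak derivatives. -/

lemma memLp_of_bounded_of_compact {c : Space → ℝ} (hc : Measurable c) {M : ℝ}
    (hM : ∀ x, |c x| ≤ M) {S : Set Space} (hS : IsCompact S) (h0 : ∀ x ∉ S, c x = 0)
    (U : Set Space) : MemLp c 2 (volume.restrict U) := by
  have h1 : S.indicator c = c := by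
    ext x
    by_cases hx : x ∈ S
    · simp [hx]
    · simp [hx, h0 x hx]
  rw [← h1]
  refine MemLp.restrict U ((memLp_indicator_iff_restrict hS.measurableSet).2 ?_)
  have : IsFiniteMeasure ((volume : Measure Space).restrict S) :=
    isFiniteMeasure_restrict.2 hS.measure_lt_top.ne
  exact MemLp.of_bound hc.aestronglyMeasurable M (Eventually.of_forall hM)

lemma integrable_smul_of_memLp {μ : Measure Space} {c : Space → ℝ} {u : Space → Spinor}
    (hc : MemLp c 2 μ) (hu : MemLp u 2 μ) : Integrable (fun x => c x • u x) μ :=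
  memLp_one_iff_integrable.1 (hu.smul hc)

lemma tendsto_integral_smul {μ : Measure Space} {c : Space → ℝ} (hc : MemLp c 2 μ)
    {w : ℕ → Space → Spinor} {u : Space → Spinor} (hw : ∀ n, MemLp (w n) 2 μ) (hu : MemLp u 2 μ)
    (h : Tendsto (fun n => eLpNorm (w n - u) 2 μ) atTop (𝓝 0)) :
    Tendsto (fun n => ∫ x, c x • w n x ∂μ) atTop (𝓝 (∫ x, c x • u x ∂μ)) := by
  refine tendsto_integral_of_L1' _ (integrable_smul_of_memLp hc hu).aestronglyMeasurable
    (Eventually.of_forall fun n => integrable_smul_of_memLp hc (hw n)) ?_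
  have h1 : Tendsto (fun n => eLpNorm c 2 μ * eLpNorm (w n - u) 2 μ) atTop (𝓝 0) := by
    simpa using ENNReal.Tendsto.const_mul h (Or.inr hc.2.ne)
  refine tendsto_of_tendsto_of_tendsto_of_le_of_le tendsto_const_nhds h1 (fun _ => zero_le)
    fun n => ?_
  have h2 : ((fun x => c x • w n x) - fun x => c x • u x) = c • (w n - u) := by
    ext1 x
    simp [smul_sub]
  simp only [h2]
  exact eLpNorm_smul_le_mul_eLpNorm ((hw n).sub hu).1 hc.1

lemma memLp_test {φ : Space → ℝ} (hφ : Continuous φ) (hc : HasCompactSupport φ)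
    (U : Set Space) : MemLp φ 2 (volume.restrict U) := by
  obtain ⟨M, hM⟩ := hc.exists_bound_of_continuous hφ
  exact memLp_of_bounded_of_compact hφ.measurable hM hc.isCompact
    (fun x hx => image_eq_zero_of_notMem_tsupport hx) U

lemma partialDeriv_eq_zero_of_notMem_tsupport {φ : Space → ℝ} {x : Space} (hx : x ∉ tsupport φ)
    (j : Fin 3) : partialDeriv j φ x = 0 := by
  have : fderiv ℝ φ x = 0 :=
    image_eq_zero_of_notMem_tsupport fun h => hx (tsupport_fderiv_subset ℝ h)
  simp [partialDeriv, this]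

lemma memLp_partialDeriv {K : NNReal} {φ : Space → ℝ} (hφ : LipschitzWith K φ)
    (hc : HasCompactSupport φ) (j : Fin 3) (U : Set Space) :
    MemLp (partialDeriv j φ) 2 (volume.restrict U) :=
  memLp_of_bounded_of_compact (measurable_partialDeriv j φ) (abs_partialDeriv_le hφ j)
    hc.isCompact (fun _ hx => partialDeriv_eq_zero_of_notMem_tsupport hx j) U

lemma exists_lipschitz_of_test {φ : Space → ℝ} (hφ : ContDiff ℝ ((⊤ : ℕ∞) : WithTop ℕ∞) φ)
    (hc : HasCompactSupport φ) : ∃ K, LipschitzWith K φ :=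
  ContDiff.lipschitzWith_of_hasCompactSupport hc hφ (by simp)

section WeakPartial

variable {U V : Set Space} {j : Fin 3} {u u' g g' : Space → Spinor}

/-- Lipschitz functions with compact support may be used as test functions. -/
lemma IsWeakPartial.integral_lipschitz (hU : IsOpen U) (hu : MemLp u 2 (volume.restrict U))
    (hg : MemLp g 2 (volume.restrict U)) (h : IsWeakPartial U j u g) {K : NNReal}
    {f : Space → ℝ} (hf : LipschitzWith K f) (hfc : HasCompactSupport f) (hfU : tsupport f ⊆ U) :
    ∫ x in U, partialDeriv j f x • u x = -∫ x in U, f x • g x := by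
  obtain ⟨F, S, M, hS, hF, hlim, hlimd⟩ := exists_smooth_approx hU hf hfc hfU
  -- All approximants are supported in the same compact set `S`, so a constant multiple of `1_S ‖w‖`
  -- dominates; it is integrable as a product of two `L²` functions.
  have hbound : ∀ (B : ℝ) {w : Space → Spinor}, MemLp w 2 (volume.restrict U) →
      Integrable (fun x => S.indicator (fun _ => B) x * ‖w x‖) (volume.restrict U) := by
    intro B w hw
    have h1 : MemLp (S.indicator fun _ => B) 2 (volume.restrict U) :=
      memLp_of_bounded_of_compact (measurable_const.indicator hS.measurableSet) (M := |B|)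
        (fun x => by by_cases hx : x ∈ S <;> simp [hx]) hS
        (fun x hx => by simp [hx]) U
    exact memLp_one_iff_integrable.1 (hw.norm.mul h1)
  have hL : Tendsto (fun n => ∫ x in U, partialDeriv j (F n) x • u x) atTop
      (𝓝 (∫ x in U, partialDeriv j f x • u x)) := by
    refine tendsto_integral_of_dominated_convergence _ (fun n => ?_) (hbound K hu) (fun n => ?_) ?_
    · exact ((measurable_partialDeriv j (F n)).aestronglyMeasurable).smul hu.1
    · refine Eventually.of_forall fun x => ?_
      by_cases hx : x ∈ S
      · rw [Set.indicator_of_mem hx, norm_smul]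
        exact mul_le_mul_of_nonneg_right ((hF n).2.2.2.2.2 j x) (norm_nonneg _)
      · simp [hx, partialDeriv_eq_zero_of_notMem_tsupport fun h => hx ((hF n).2.2.2.1 h)]
    · filter_upwards [ae_restrict_of_ae (hlimd j)] with x hx
      exact hx.smul_const _
  have hR : Tendsto (fun n => ∫ x in U, F n x • g x) atTop (𝓝 (∫ x in U, f x • g x)) := by
    refine tendsto_integral_of_dominated_convergence _ (fun n => ?_) (hbound M hg) (fun n => ?_) ?_
    · exact ((hF n).1.continuous.aestronglyMeasurable).smul hg.1
    · refine Eventually.of_forall fun x => ?_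
      by_cases hx : x ∈ S
      · rw [Set.indicator_of_mem hx, norm_smul]
        exact mul_le_mul_of_nonneg_right ((hF n).2.2.2.2.1 x) (norm_nonneg _)
      · simp [hx, image_eq_zero_of_notMem_tsupport fun h => hx ((hF n).2.2.2.1 h)]
    · exact Eventually.of_forall fun x => (hlim x).smul_const _
  refine tendsto_nhds_unique hL (hR.neg.congr fun n => ?_)
  exact (h (F n) (hF n).1 (hF n).2.1 (hF n).2.2.1).symm

lemma IsWeakPartial.ae_eq (hU : IsOpen U) (hg : MemLp g 2 (volume.restrict U))
    (hg' : MemLp g' 2 (volume.restrict U)) (h : IsWeakPartial U j u g)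
    (h' : IsWeakPartial U j u g') : g =ᵐ[volume.restrict U] g' := by
  have hloc : LocallyIntegrableOn (g - g') U :=
    locallyIntegrableOn_of_locallyIntegrable_restrict
      ((hg.sub hg').locallyIntegrable (by norm_num))
  have key := hU.ae_eq_zero_of_integral_contDiff_smul_eq_zero hloc fun φ hφ hc hs => ?_
  · refine (ae_restrict_iff' hU.measurableSet).2 ?_
    filter_upwards [key] with x hx hxU
    exact sub_eq_zero.1 (hx hxU)
  · rw [← setIntegral_eq_integral_of_forall_compl_eq_zero (s := U)]
    · have hm := memLp_test hφ.continuous hc U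
      have h1 := (h φ hφ hc hs).symm.trans (h' φ hφ hc hs)
      simp only [Pi.sub_apply, smul_sub]
      rw [integral_sub (integrable_smul_of_memLp hm hg) (integrable_smul_of_memLp hm hg'),
        neg_inj.1 h1, sub_self]
    · intro x hx
      rw [image_eq_zero_of_notMem_tsupport fun h => hx (hs h), zero_smul]

lemma IsWeakPartial.congr (h : IsWeakPartial U j u g) (hu : u =ᵐ[volume.restrict U] u')
    (hg : g =ᵐ[volume.restrict U] g') : IsWeakPartial U j u' g' := by
  intro φ hφ hc hs
  rw [← integral_congr_ae (hu.mono fun x hx => congrArg _ hx), h φ hφ hc hs,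
    integral_congr_ae (hg.mono fun x hx => congrArg _ hx)]

lemma IsWeakPartial.mono (h : IsWeakPartial U j u g) (hVU : V ⊆ U) : IsWeakPartial V j u g := by
  intro φ hφ hc hs
  have h1 : ∀ W : Set Space, V ⊆ W → (∫ x in W, partialDeriv j φ x • u x
      = ∫ x, partialDeriv j φ x • u x) ∧ ∫ x in W, φ x • g x = ∫ x, φ x • g x := by
    refine fun W hW => ⟨setIntegral_eq_integral_of_forall_compl_eq_zero fun x hx => ?_,
      setIntegral_eq_integral_of_forall_compl_eq_zero fun x hx => ?_⟩
    · rw [partialDeriv_eq_zero_of_notMem_tsupport fun h => hx (hW (hs h)), zero_smul]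
    · rw [image_eq_zero_of_notMem_tsupport fun h => hx (hW (hs h)), zero_smul]
  have h2 := h φ hφ hc (hs.trans hVU)
  change ∫ x in V, partialDeriv j φ x • u x = _
  rw [(h1 V subset_rfl).1, (h1 V subset_rfl).2, ← (h1 U hVU).1, ← (h1 U hVU).2]
  exact h2

lemma IsWeakPartial.add (hu : MemLp u 2 (volume.restrict U)) (hu' : MemLp u' 2 (volume.restrict U))
    (hg : MemLp g 2 (volume.restrict U)) (hg' : MemLp g' 2 (volume.restrict U))
    (h : IsWeakPartial U j u g) (h' : IsWeakPartial U j u' g') :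
    IsWeakPartial U j (u + u') (g + g') := by
  intro φ hφ hc hs
  obtain ⟨K, hK⟩ := exists_lipschitz_of_test hφ hc
  have hm := memLp_test hφ.continuous hc U
  have hd := memLp_partialDeriv hK hc j U
  change ∫ x in U, partialDeriv j φ x • (u x + u' x) = -∫ x in U, φ x • (g x + g' x)
  simp only [smul_add]
  rw [integral_add (integrable_smul_of_memLp hd hu) (integrable_smul_of_memLp hd hu'),
    integral_add (integrable_smul_of_memLp hm hg) (integrable_smul_of_memLp hm hg'), neg_add]
  exact congrArg₂ _ (h φ hφ hc hs) (h' φ hφ hc hs)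

/-- Weak differentiation is a closed operator, since both sides of its defining identity are
`L²`-continuous. This passes extension by zero to `H¹` limits. -/
lemma isWeakPartial_of_tendsto {w a : ℕ → Space → Spinor}
    (hw : ∀ n, MemLp (w n) 2 (volume.restrict U)) (ha : ∀ n, MemLp (a n) 2 (volume.restrict U))
    (hu : MemLp u 2 (volume.restrict U)) (hg : MemLp g 2 (volume.restrict U))
    (h : ∀ n, IsWeakPartial U j (w n) (a n))
    (hwu : Tendsto (fun n => eLpNorm (w n - u) 2 (volume.restrict U)) atTop (𝓝 0))
    (hag : Tendsto (fun n => eLpNorm (a n - g) 2 (volume.restrict U)) atTop (𝓝 0)) :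
    IsWeakPartial U j u g := by
  intro φ hφ hc hs
  obtain ⟨K, hK⟩ := exists_lipschitz_of_test hφ hc
  refine tendsto_nhds_unique (tendsto_integral_smul (memLp_partialDeriv hK hc j U) hw hu hwu)
    ((tendsto_integral_smul (memLp_test hφ.continuous hc U) ha hg hag).neg.congr fun n => ?_)
  exact (h n φ hφ hc hs).symm

end WeakPartial

/-! ### Multiplication by bounded Lipschitz functions. -/

/-- Bounded Lipschitz functions. -/
def IsMultiplier (ψ : Space → ℝ) : Prop :=
  (∃ K, LipschitzWith K ψ) ∧ ∃ M, ∀ x, |ψ x| ≤ M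

namespace IsMultiplier

variable {ψ χ : Space → ℝ}

lemma const (c : ℝ) : IsMultiplier fun _ => c :=
  ⟨⟨0, LipschitzWith.const c⟩, |c|, fun _ => le_rfl⟩

lemma continuous (h : IsMultiplier ψ) : Continuous ψ :=
  let ⟨⟨_, hK⟩, _⟩ := h
  hK.continuous

lemma add (h : IsMultiplier ψ) (h' : IsMultiplier χ) : IsMultiplier fun x => ψ x + χ x := by
  obtain ⟨⟨K, hK⟩, M, hM⟩ := h
  obtain ⟨⟨K', hK'⟩, M', hM'⟩ := h'
  exact ⟨⟨_, hK.add hK'⟩, M + M', fun x => (abs_add_le _ _).trans (add_le_add (hM x) (hM' x))⟩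

lemma mul (h : IsMultiplier ψ) (h' : IsMultiplier χ) : IsMultiplier fun x => ψ x * χ x := by
  obtain ⟨⟨K, hK⟩, M, hM⟩ := h
  obtain ⟨⟨K', hK'⟩, M', hM'⟩ := h'
  have hM0 : 0 ≤ M := (abs_nonneg _).trans (hM 0)
  have hM'0 : 0 ≤ M' := (abs_nonneg _).trans (hM' 0)
  refine ⟨⟨⟨M * K' + M' * K, by positivity⟩, LipschitzWith.of_dist_le_mul fun x y => ?_⟩,
    M * M', fun x => ?_⟩
  · have h1 := hK.dist_le_mul x y
    have h2 := hK'.dist_le_mul x y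
    rw [Real.dist_eq] at h1 h2 ⊢
    rw [show ψ x * χ x - ψ y * χ y = ψ x * (χ x - χ y) + χ y * (ψ x - ψ y) by ring]
    refine (abs_add_le _ _).trans ?_
    rw [abs_mul, abs_mul]
    have h3 := mul_le_mul (hM x) h2 (abs_nonneg _) hM0
    have h4 := mul_le_mul (hM' y) h1 (abs_nonneg _) hM'0
    refine (add_le_add h3 h4).trans (le_of_eq ?_)
    change _ = (M * K' + M' * K) * dist x y
    ring
  · rw [abs_mul]
    exact mul_le_mul (hM x) (hM' x) (abs_nonneg _) hM0

lemma smul (h : IsMultiplier ψ) (c : ℝ) : IsMultiplier fun x => c * ψ x := (const c).mul h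

lemma one_sub (h : IsMultiplier ψ) : IsMultiplier fun x => 1 - ψ x := by
  simpa [sub_eq_add_neg] using (const 1).add (h.smul (-1))

lemma sq (h : IsMultiplier ψ) : IsMultiplier fun x => ψ x ^ 2 := by
  simpa [pow_two] using h.mul h

lemma ae_differentiableAt (h : IsMultiplier ψ) (U : Set Space) :
    ∀ᵐ x ∂(volume.restrict U), DifferentiableAt ℝ ψ x :=
  let ⟨⟨_, hK⟩, _⟩ := h
  ae_restrict_of_ae hK.ae_differentiableAt

lemma memLp_smul (h : IsMultiplier ψ) {μ : Measure Space} {u : Space → Spinor}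
    (hu : MemLp u 2 μ) : MemLp (fun x => ψ x • u x) 2 μ := by
  obtain ⟨M, hM⟩ := h.2
  refine hu.of_le_mul (c := M) (h.continuous.aestronglyMeasurable.smul hu.1)
    (Eventually.of_forall fun x => ?_)
  rw [norm_smul]
  exact mul_le_mul_of_nonneg_right (hM x) (norm_nonneg _)

lemma memLp_partialDeriv_smul (h : IsMultiplier ψ) {μ : Measure Space} {u : Space → Spinor}
    (hu : MemLp u 2 μ) (j : Fin 3) : MemLp (fun x => partialDeriv j ψ x • u x) 2 μ := by
  obtain ⟨K, hK⟩ := h.1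
  refine hu.of_le_mul (c := K) ((measurable_partialDeriv j ψ).aestronglyMeasurable.smul hu.1)
    (Eventually.of_forall fun x => ?_)
  rw [norm_smul]
  exact mul_le_mul_of_nonneg_right (abs_partialDeriv_le hK j x) (norm_nonneg _)

lemma partialDeriv_mul {x : Space} (h : DifferentiableAt ℝ ψ x) (h' : DifferentiableAt ℝ χ x)
    (j : Fin 3) : partialDeriv j (fun y => ψ y * χ y) x
      = ψ x * partialDeriv j χ x + χ x * partialDeriv j ψ x := by
  simp [partialDeriv, fderiv_fun_mul h h']

/-- The product rule. -/
lemma isWeakPartial (h : IsMultiplier ψ) {U : Set Space} (hU : IsOpen U) {j : Fin 3}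
    {u g : Space → Spinor} (hu : MemLp u 2 (volume.restrict U))
    (hg : MemLp g 2 (volume.restrict U)) (hw : IsWeakPartial U j u g) :
    IsWeakPartial U j (fun x => ψ x • u x) (fun x => ψ x • g x + partialDeriv j ψ x • u x) := by
  intro φ hφ hc hs
  obtain ⟨K, hK⟩ := exists_lipschitz_of_test hφ hc
  obtain ⟨M, hM⟩ := hc.exists_bound_of_continuous hφ.continuous
  have hφm : IsMultiplier φ := ⟨⟨K, hK⟩, M, hM⟩
  obtain ⟨L, hL⟩ := (hφm.mul h).1
  have hfc : HasCompactSupport fun x => φ x * ψ x := hc.mul_right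
  have hts : tsupport (fun x => φ x * ψ x) ⊆ U := (tsupport_mul_subset_left).trans hs
  -- The product rule comes from testing `u` against `φψ`, which is only Lipschitz.
  have key := hw.integral_lipschitz hU hu hg hL hfc hts
  have hm := memLp_test hφ.continuous hc U
  have hd := memLp_partialDeriv hK hc j U
  have hψu := h.memLp_smul hu
  have hpu := h.memLp_partialDeriv_smul hu j
  have hψg := h.memLp_smul hg
  have h1 : ∫ x in U, partialDeriv j (fun x => φ x * ψ x) x • u x
      = ∫ x in U, (φ x • (partialDeriv j ψ x • u x) + partialDeriv j φ x • (ψ x • u x)) := by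
    refine integral_congr_ae ?_
    filter_upwards [h.ae_differentiableAt U] with x hx
    rw [partialDeriv_mul ((hφ.differentiable (by simp)) x) hx, add_smul, smul_smul, smul_smul,
      mul_comm (ψ x)]
  rw [h1, integral_add (integrable_smul_of_memLp hm hpu) (integrable_smul_of_memLp hd hψu)] at key
  change ∫ x in U, partialDeriv j φ x • (ψ x • u x) = _
  simp only [smul_add]
  rw [integral_add (integrable_smul_of_memLp hm hψg) (integrable_smul_of_memLp hm hpu), neg_add,
    eq_sub_of_add_eq' key]
  simp only [smul_smul]
  abel

end IsMultiplier

/-! ### Operations on `H¹` functions, `H¹` limits and traces. -/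

section Sobolev

variable {U V : Set Space} {j : Fin 3} {u w g : Space → Spinor} {ψ : Space → ℝ}

lemma HasL2Partial.memLp (h : HasL2Partial U j u) :
    MemLp (weakPartial U j u) 2 (volume.restrict U) := by
  rw [weakPartial, dif_pos h]
  exact h.choose_spec.1

lemma HasL2Partial.isWeakPartial (h : HasL2Partial U j u) :
    IsWeakPartial U j u (weakPartial U j u) := by
  rw [weakPartial, dif_pos h]
  exact h.choose_spec.2

lemma weakPartial_ae_eq (hU : IsOpen U) (hg : MemLp g 2 (volume.restrict U))
    (h : IsWeakPartial U j u g) : weakPartial U j u =ᵐ[volume.restrict U] g :=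
  have h' : HasL2Partial U j u := ⟨g, hg, h⟩
  h'.isWeakPartial.ae_eq hU h'.memLp hg h

lemma MemH1.memLp_weakPartial (h : MemH1 U u) (j : Fin 3) :
    MemLp (weakPartial U j u) 2 (volume.restrict U) := (h.2 j).memLp

lemma MemH1.isWeakPartial (h : MemH1 U u) (j : Fin 3) :
    IsWeakPartial U j u (weakPartial U j u) := (h.2 j).isWeakPartial

lemma MemH1.smul (h : MemH1 U u) (hU : IsOpen U) (hψ : IsMultiplier ψ) :
    MemH1 U fun x => ψ x • u x :=
  ⟨hψ.memLp_smul h.1, fun j => ⟨_,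
    (hψ.memLp_smul (h.memLp_weakPartial j)).add (hψ.memLp_partialDeriv_smul h.1 j),
    hψ.isWeakPartial hU h.1 (h.memLp_weakPartial j) (h.isWeakPartial j)⟩⟩

lemma MemH1.weakPartial_smul (h : MemH1 U u) (hU : IsOpen U) (hψ : IsMultiplier ψ) (j : Fin 3) :
    weakPartial U j (fun x => ψ x • u x) =ᵐ[volume.restrict U]
      fun x => ψ x • weakPartial U j u x + partialDeriv j ψ x • u x :=
  weakPartial_ae_eq hU
    ((hψ.memLp_smul (h.memLp_weakPartial j)).add (hψ.memLp_partialDeriv_smul h.1 j))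
    (hψ.isWeakPartial hU h.1 (h.memLp_weakPartial j) (h.isWeakPartial j))

lemma MemH1.add (h : MemH1 U u) (h' : MemH1 U w) : MemH1 U (u + w) :=
  ⟨h.1.add h'.1, fun j => ⟨_, (h.memLp_weakPartial j).add (h'.memLp_weakPartial j),
    (h.isWeakPartial j).add h.1 h'.1 (h.memLp_weakPartial j) (h'.memLp_weakPartial j)
      (h'.isWeakPartial j)⟩⟩

lemma MemH1.weakPartial_add (h : MemH1 U u) (h' : MemH1 U w) (hU : IsOpen U) (j : Fin 3) :
    weakPartial U j (u + w) =ᵐ[volume.restrict U] weakPartial U j u + weakPartial U j w :=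
  weakPartial_ae_eq hU ((h.memLp_weakPartial j).add (h'.memLp_weakPartial j))
    ((h.isWeakPartial j).add h.1 h'.1 (h.memLp_weakPartial j) (h'.memLp_weakPartial j)
      (h'.isWeakPartial j))

lemma memLp_restrict_mono (h : MemLp u 2 (volume.restrict U)) (hVU : V ⊆ U) :
    MemLp u 2 (volume.restrict V) :=
  h.mono_measure (Measure.restrict_mono_set _ hVU)

lemma MemH1.mono (h : MemH1 U u) (hVU : V ⊆ U) : MemH1 V u :=
  ⟨memLp_restrict_mono h.1 hVU, fun j => ⟨_, memLp_restrict_mono (h.memLp_weakPartial j) hVU,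
    (h.isWeakPartial j).mono hVU⟩⟩

lemma MemH1.weakPartial_mono (h : MemH1 U u) (hV : IsOpen V) (hVU : V ⊆ U) (j : Fin 3) :
    weakPartial V j u =ᵐ[volume.restrict V] weakPartial U j u :=
  weakPartial_ae_eq hV (memLp_restrict_mono (h.memLp_weakPartial j) hVU)
    ((h.isWeakPartial j).mono hVU)

lemma tendsto_zero_of_le {α : Type*} {l : Filter α} {f g : α → ENNReal}
    (hg : Tendsto g l (𝓝 0)) (h : ∀ n, f n ≤ g n) : Tendsto f l (𝓝 0) :=
  tendsto_of_tendsto_of_tendsto_of_le_of_le tendsto_const_nhds hg (fun _ => zero_le) h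

variable {φ : ℕ → Space → Spinor}

lemma TendstoH1.smul (h : TendstoH1 U φ u) (hU : IsOpen U) (hφ : ∀ n, MemH1 U (φ n))
    (hu : MemH1 U u) (hψ : IsMultiplier ψ) :
    TendstoH1 U (fun n x => ψ x • φ n x) (fun x => ψ x • u x) := by
  obtain ⟨⟨K, hK⟩, M, hM⟩ := id hψ
  have h1 : ∀ (f : Space → Spinor), eLpNorm (fun x => ψ x • f x) 2 (volume.restrict U)
      ≤ ENNReal.ofReal M * eLpNorm f 2 (volume.restrict U) := fun f =>
    eLpNorm_le_mul_eLpNorm_of_ae_le_mul (Eventually.of_forall fun x => by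
      rw [norm_smul]; exact mul_le_mul_of_nonneg_right (hM x) (norm_nonneg _)) 2
  have h2 : ∀ (j : Fin 3) (f : Space → Spinor),
      eLpNorm (fun x => partialDeriv j ψ x • f x) 2 (volume.restrict U)
      ≤ ENNReal.ofReal K * eLpNorm f 2 (volume.restrict U) := fun j f =>
    eLpNorm_le_mul_eLpNorm_of_ae_le_mul (Eventually.of_forall fun x => by
      rw [norm_smul]
      exact mul_le_mul_of_nonneg_right (abs_partialDeriv_le hK j x) (norm_nonneg _)) 2
  have h3 : ∀ (c : ℝ) {f : ℕ → ENNReal}, Tendsto f atTop (𝓝 0) →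
      Tendsto (fun n => ENNReal.ofReal c * f n) atTop (𝓝 0) := fun c f hf => by
    simpa using ENNReal.Tendsto.const_mul hf (Or.inr ENNReal.ofReal_ne_top)
  refine ⟨tendsto_zero_of_le (h3 M h.1) fun n => ?_, fun j => ?_⟩
  · refine le_of_eq_of_le (congrArg (fun f => eLpNorm f 2 (volume.restrict U)) ?_) (h1 _)
    ext1 x
    simp [smul_sub]
  · have h4 := (h3 M (h.2 j)).add (h3 K h.1)
    rw [add_zero] at h4
    refine tendsto_zero_of_le h4 fun n => ?_
    have h5 : weakPartial U j (fun x => ψ x • φ n x) - weakPartial U j (fun x => ψ x • u x)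
        =ᵐ[volume.restrict U]
        (fun x => ψ x • (weakPartial U j (φ n) - weakPartial U j u) x) +
          fun x => partialDeriv j ψ x • (φ n - u) x := by
      filter_upwards [(hφ n).weakPartial_smul hU hψ j, hu.weakPartial_smul hU hψ j] with x hx hx'
      simp only [Pi.sub_apply, Pi.add_apply, hx, hx', smul_sub]
      abel
    rw [eLpNorm_congr_ae h5]
    refine (eLpNorm_add_le (hψ.memLp_smul (((hφ n).memLp_weakPartial j).sub
      (hu.memLp_weakPartial j))).1 (hψ.memLp_partialDeriv_smul ((hφ n).1.sub hu.1) j).1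
      (by norm_num)).trans ?_
    exact add_le_add (h1 _) (h2 j _)

lemma TendstoH1.add_const (h : TendstoH1 U φ u) (hU : IsOpen U) (hφ : ∀ n, MemH1 U (φ n))
    (hu : MemH1 U u) (hw : MemH1 U w) : TendstoH1 U (fun n => φ n + w) (u + w) := by
  refine ⟨by simpa using h.1, fun j => (h.2 j).congr fun n => eLpNorm_congr_ae ?_⟩
  filter_upwards [(hφ n).weakPartial_add hw hU j, hu.weakPartial_add hw hU j] with x hx hx'
  simp [hx, hx']

lemma TendstoH1.mono (h : TendstoH1 U φ u) (hV : IsOpen V) (hVU : V ⊆ U)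
    (hφ : ∀ n, MemH1 U (φ n)) (hu : MemH1 U u) : TendstoH1 V φ u := by
  have hm := Measure.restrict_mono_set (volume : Measure Space) hVU
  refine ⟨tendsto_zero_of_le h.1 fun n => eLpNorm_mono_measure _ hm, fun j =>
    tendsto_zero_of_le (h.2 j) fun n => ?_⟩
  rw [eLpNorm_congr_ae (((hφ n).weakPartial_mono hV hVU j).sub (hu.weakPartial_mono hV hVU j))]
  exact eLpNorm_mono_measure _ hm

/-- `weakPartial` is chosen separately for each function, so even a change on a null set requires
uniqueness of weak derivatives. -/
lemma TendstoH1.congr_limit {u' : Space → Spinor} (h : TendstoH1 U φ u) (hU : IsOpen U)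
    (hu : MemH1 U u) (huu' : u =ᵐ[volume.restrict U] u') : TendstoH1 U φ u' := by
  refine ⟨h.1.congr fun n => eLpNorm_congr_ae (EventuallyEq.rfl.sub huu'), fun j =>
    (h.2 j).congr fun n => eLpNorm_congr_ae (EventuallyEq.rfl.sub ?_)⟩
  exact (weakPartial_ae_eq hU (hu.memLp_weakPartial j)
    ((hu.isWeakPartial j).congr huu' EventuallyEq.rfl)).symm

lemma tendstoH1_const (u : Space → Spinor) : TendstoH1 U (fun _ => u) u := by
  simp [TendstoH1]

variable {Γ : Set Space}

/-- Multiplying the approximants by `ψ` does not alter them on `Γ`, so the same `g` serves. -/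
lemma HasTrace.smul (h : HasTrace U Γ u g) (hU : IsOpen U) (hΓ : MeasurableSet Γ)
    (hu : MemH1 U u) (hψ : IsMultiplier ψ) (h1 : ∀ x ∈ Γ, ψ x = 1) :
    HasTrace U Γ (fun x => ψ x • u x) g := by
  obtain ⟨hg, φ, hφ, hlim, htr⟩ := h
  refine ⟨hg, fun n x => ψ x • φ n x, fun n => ⟨(hφ n).1.smul hU hψ, ?_⟩,
    hlim.smul hU (fun n => (hφ n).1) hu hψ, htr.congr fun n => eLpNorm_congr_ae ?_⟩
  · obtain ⟨W, hW, hΓW, hc⟩ := (hφ n).2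
    exact ⟨W, hW, hΓW, hψ.continuous.continuousOn.smul hc⟩
  · filter_upwards [ae_restrict_mem hΓ] with x hx
    simp [h1 x hx]

lemma HasTrace.mono (h : HasTrace U Γ u g) (hV : IsOpen V) (hVU : V ⊆ U)
    (hu : MemH1 U u) : HasTrace V Γ u g := by
  obtain ⟨hg, φ, hφ, hlim, htr⟩ := h
  refine ⟨hg, φ, fun n => ⟨(hφ n).1.mono hVU, ?_⟩, hlim.mono hV hVU (fun n => (hφ n).1) hu, htr⟩
  obtain ⟨W, hW, hΓW, hc⟩ := (hφ n).2
  exact ⟨W, hW, hΓW, hc.mono (Set.inter_subset_inter_left _ (Set.union_subset_union_left _ hVU))⟩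

end Sobolev

/-! ### Extension by zero. -/

section Extension

variable {U T : Set Space} {u w : Space → Spinor} {j : Fin 3}

lemma memLp_indicator_of_inter (hT : MeasurableSet T)
    (hu : MemLp u 2 (volume.restrict (U ∩ T))) :
    MemLp (T.indicator u) 2 (volume.restrict U) := by
  rw [memLp_indicator_iff_restrict hT, Measure.restrict_restrict hT, Set.inter_comm]
  exact hu

lemma eLpNorm_indicator_sub (hT : MeasurableSet T) (u w : Space → Spinor) :
    eLpNorm (T.indicator u - T.indicator w) 2 (volume.restrict U)
      = eLpNorm (u - w) 2 (volume.restrict (U ∩ T)) := by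
  rw [← Set.indicator_sub', eLpNorm_indicator_eq_eLpNorm_restrict hT,
    Measure.restrict_restrict hT, Set.inter_comm]

lemma integral_smul_indicator (hT : MeasurableSet T) (c : Space → ℝ) (u : Space → Spinor) :
    ∫ x in U, c x • T.indicator u x = ∫ x in U ∩ T, c x • u x := by
  rw [← setIntegral_indicator hT]
  congr 1
  ext1 x
  by_cases hx : x ∈ T <;> simp [hx]

/-- The extension by zero of a function on `U ∩ T` to `U` has the extended weak derivatives. -/
def ExtendsByZero (U T : Set Space) (u : Space → Spinor) : Prop :=
  ∀ j, IsWeakPartial U j (T.indicator u) (T.indicator (weakPartial (U ∩ T) j u))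

lemma ExtendsByZero.memH1 (h : ExtendsByZero U T u) (hT : MeasurableSet T)
    (hu : MemH1 (U ∩ T) u) : MemH1 U (T.indicator u) :=
  ⟨memLp_indicator_of_inter hT hu.1, fun j =>
    ⟨_, memLp_indicator_of_inter hT (hu.memLp_weakPartial j), h j⟩⟩

lemma ExtendsByZero.weakPartial_ae_eq (h : ExtendsByZero U T u) (hU : IsOpen U)
    (hT : MeasurableSet T) (hu : MemH1 (U ∩ T) u) (j : Fin 3) :
    weakPartial U j (T.indicator u) =ᵐ[volume.restrict U]
      T.indicator (weakPartial (U ∩ T) j u) :=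
  MITBag.weakPartial_ae_eq hU (memLp_indicator_of_inter hT (hu.memLp_weakPartial j)) (h j)

lemma TendstoH1.indicator {φ : ℕ → Space → Spinor} (h : TendstoH1 (U ∩ T) φ u) (hU : IsOpen U)
    (hT : MeasurableSet T) (hφ : ∀ n, MemH1 (U ∩ T) (φ n)) (hu : MemH1 (U ∩ T) u)
    (hφe : ∀ n, ExtendsByZero U T (φ n)) (hue : ExtendsByZero U T u) :
    TendstoH1 U (fun n => T.indicator (φ n)) (T.indicator u) := by
  refine ⟨by simpa only [eLpNorm_indicator_sub hT] using h.1, fun j => (h.2 j).congr fun n => ?_⟩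
  rw [eLpNorm_congr_ae (((hφe n).weakPartial_ae_eq hU hT (hφ n) j).sub
    (hue.weakPartial_ae_eq hU hT hu j)), eLpNorm_indicator_sub hT]

lemma ExtendsByZero.of_tendsto {φ : ℕ → Space → Spinor} (h : TendstoH1 (U ∩ T) φ u)
    (hT : MeasurableSet T) (hφ : ∀ n, MemH1 (U ∩ T) (φ n)) (hu : MemH1 (U ∩ T) u)
    (hφe : ∀ n, ExtendsByZero U T (φ n)) : ExtendsByZero U T u := fun j =>
  isWeakPartial_of_tendsto (fun n => memLp_indicator_of_inter hT (hφ n).1)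
    (fun n => memLp_indicator_of_inter hT ((hφ n).memLp_weakPartial j))
    (memLp_indicator_of_inter hT hu.1) (memLp_indicator_of_inter hT (hu.memLp_weakPartial j))
    (fun n => hφe n j) (by simpa only [eLpNorm_indicator_sub hT] using h.1)
    (by simpa only [eLpNorm_indicator_sub hT] using h.2 j)

lemma energy_indicator (h : ExtendsByZero U T u) (hU : IsOpen U) (hT : MeasurableSet T)
    (hu : MemH1 (U ∩ T) u) (m : ℝ) : energy U m (T.indicator u) = energy (U ∩ T) m u := by
  have h1 : ∀ f : Space → Spinor, ∫ x in U, ‖T.indicator f x‖ ^ 2 = ∫ x in U ∩ T, ‖f x‖ ^ 2 := by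
    intro f
    rw [← setIntegral_indicator hT]
    congr 1
    ext1 x
    by_cases hx : x ∈ T <;> simp [hx]
  unfold energy
  rw [h1]
  congr 1
  refine Finset.sum_congr rfl fun j _ => ?_
  rw [← h1]
  refine integral_congr_ae ?_
  filter_upwards [h.weakPartial_ae_eq hU hT hu j] with x hx
  rw [hx]

end Extension

/-! ### Cutoffs near the boundary and the comparison `Λ_m ≤ Λ_{m,δ}`. -/

section Cutoff

variable {Ω : Set Space}

/-- The points at distance less than `δ` from the boundary. -/
def nearBoundary (Ω : Set Space) (δ : ℝ) : Set Space := {x | Metric.infDist x (frontier Ω) < δ}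

lemma isOpen_nearBoundary (Ω : Set Space) (δ : ℝ) : IsOpen (nearBoundary Ω δ) :=
  isOpen_lt (Metric.continuous_infDist_pt _) continuous_const

lemma isOpen_exterior (Ω : Set Space) : IsOpen (exterior Ω) := isClosed_closure.isOpen_compl

lemma tube_eq (Ω : Set Space) (δ : ℝ) : tube Ω δ = exterior Ω ∩ nearBoundary Ω δ := rfl

lemma isOpen_tube (Ω : Set Space) (δ : ℝ) : IsOpen (tube Ω δ) :=
  (isOpen_exterior Ω).inter (isOpen_nearBoundary Ω δ)

lemma tube_subset_exterior (Ω : Set Space) (δ : ℝ) : tube Ω δ ⊆ exterior Ω :=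
  Set.inter_subset_left

/-- The cutoff function which is `1` up to distance `a` from the boundary, and `0` from distance `b`
on. -/
def cutoff (Ω : Set Space) (a b : ℝ) (x : Space) : ℝ :=
  max 0 (min 1 ((b - Metric.infDist x (frontier Ω)) / (b - a)))

variable {a b : ℝ}

lemma cutoff_nonneg (x : Space) : 0 ≤ cutoff Ω a b x := le_max_left _ _

lemma cutoff_le_one (x : Space) : cutoff Ω a b x ≤ 1 := by simp [cutoff]

lemma cutoff_eq_one (hab : a < b) {x : Space} (hx : Metric.infDist x (frontier Ω) ≤ a) :
    cutoff Ω a b x = 1 := by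
  have : 1 ≤ (b - Metric.infDist x (frontier Ω)) / (b - a) := by
    rw [le_div_iff₀ (sub_pos.2 hab)]
    linarith
  simp [cutoff, this]

lemma cutoff_eq_zero (hab : a < b) {x : Space} (hx : b ≤ Metric.infDist x (frontier Ω)) :
    cutoff Ω a b x = 0 := by
  have : (b - Metric.infDist x (frontier Ω)) / (b - a) ≤ 0 :=
    div_nonpos_of_nonpos_of_nonneg (by linarith) (sub_pos.2 hab).le
  simp [cutoff, this]

lemma lipschitzWith_cutoff (hab : a < b) :
    LipschitzWith ⟨1 / (b - a), (one_div_pos.2 (sub_pos.2 hab)).le⟩ (cutoff Ω a b) := by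
  have h : LipschitzWith ⟨1 / (b - a), (one_div_pos.2 (sub_pos.2 hab)).le⟩
      fun x => (b - Metric.infDist x (frontier Ω)) / (b - a) := by
    refine LipschitzWith.of_dist_le_mul fun x y => ?_
    have h1 := (Metric.lipschitz_infDist_pt (frontier Ω)).dist_le_mul x y
    rw [Real.dist_eq] at h1 ⊢
    rw [show (b - Metric.infDist x (frontier Ω)) / (b - a)
      - (b - Metric.infDist y (frontier Ω)) / (b - a)
      = -(1 / (b - a) * (Metric.infDist x (frontier Ω) - Metric.infDist y (frontier Ω))) by ring,
      abs_neg, abs_mul, abs_of_pos (one_div_pos.2 (sub_pos.2 hab))]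
    refine mul_le_mul_of_nonneg_left ?_ (one_div_pos.2 (sub_pos.2 hab)).le
    simpa using h1
  exact (h.const_min 1).const_max 0

lemma isMultiplier_cutoff (hab : a < b) : IsMultiplier (cutoff Ω a b) :=
  ⟨⟨_, lipschitzWith_cutoff hab⟩, 1, fun x => by
    rw [abs_of_nonneg (cutoff_nonneg x)]; exact cutoff_le_one x⟩

lemma fderiv_cutoff_eq_zero (hab : a < b) {x : Space} (hx : Metric.infDist x (frontier Ω) < a) :
    fderiv ℝ (cutoff Ω a b) x = 0 := by
  have : cutoff Ω a b =ᶠ[𝓝 x] fun _ => (1 : ℝ) := by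
    filter_upwards [(isOpen_nearBoundary Ω a).mem_nhds hx] with y hy
    exact cutoff_eq_one hab (le_of_lt hy)
  rw [this.fderiv_eq, fderiv_fun_const, Pi.zero_apply]

/-- Functions vanishing near the outer boundary of the tube can be extended by zero. -/
lemma extendsByZero_of_vanishing {δ δ' : ℝ} (hδ : δ' < δ) {w : Space → Spinor}
    (hw : MemH1 (tube Ω δ) w)
    (h0 : ∀ x ∈ tube Ω δ, δ' < Metric.infDist x (frontier Ω) → w x = 0) :
    ExtendsByZero (exterior Ω) (nearBoundary Ω δ) w := by
  intro j φ hφ hc hs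
  have hT := (isOpen_nearBoundary Ω δ).measurableSet
  obtain ⟨K, hK⟩ := exists_lipschitz_of_test hφ hc
  obtain ⟨M, hM⟩ := hc.exists_bound_of_continuous hφ.continuous
  -- With `δ' < a < b < δ`, the cutoff makes `φ` a test function on the tube, yet it equals 1 on a
  -- neighbourhood of the set where `w` may be nonzero, so neither integral changes.
  obtain ⟨b, hb1, hb2⟩ := exists_between hδ
  obtain ⟨a, ha1, ha2⟩ := exists_between hb1
  have hφm : IsMultiplier φ := ⟨⟨K, hK⟩, M, hM⟩
  have hmul := hφm.mul (isMultiplier_cutoff (Ω := Ω) ha2)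
  obtain ⟨L, hL⟩ := hmul.1
  have hts : tsupport (fun x => φ x * cutoff Ω a b x) ⊆ tube Ω δ := by
    refine fun x hx => ⟨hs (tsupport_mul_subset_left hx), ?_⟩
    have h1 : tsupport (fun x => φ x * cutoff Ω a b x)
        ⊆ {x | Metric.infDist x (frontier Ω) ≤ b} := by
      refine closure_minimal (fun y hy => ?_)
        (isClosed_le (Metric.continuous_infDist_pt _) continuous_const)
      by_contra hyb
      exact hy (by simp [cutoff_eq_zero ha2 (not_le.1 hyb).le])
    exact (h1 hx).trans_lt hb2
  have key := (hw.isWeakPartial j).integral_lipschitz (isOpen_tube Ω δ) hw.1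
    (hw.memLp_weakPartial j) hL hc.mul_right hts
  have hV' : IsOpen (tube Ω δ ∩ {x | δ' < Metric.infDist x (frontier Ω)}) :=
    (isOpen_tube Ω δ).inter (isOpen_lt continuous_const (Metric.continuous_infDist_pt _))
  -- Locality: on the open set where `w` vanishes, zero is also a weak derivative, and weak
  -- derivatives are unique.
  have hz : ∀ᵐ x ∂(volume.restrict (tube Ω δ)), δ' < Metric.infDist x (frontier Ω) →
      weakPartial (tube Ω δ) j w x = 0 := by
    have h1 : IsWeakPartial (tube Ω δ ∩ {x | δ' < Metric.infDist x (frontier Ω)}) j w 0 := by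
      have h2 : IsWeakPartial (tube Ω δ ∩ {x | δ' < Metric.infDist x (frontier Ω)}) j
        (0 : Space → Spinor) 0 := fun _ _ _ _ => by simp
      refine h2.congr ?_ EventuallyEq.rfl
      filter_upwards [ae_restrict_mem hV'.measurableSet] with x hx
      exact (h0 x hx.1 hx.2).symm
    have h3 := ((hw.isWeakPartial j).mono (Set.inter_subset_left)).ae_eq hV'
      (memLp_restrict_mono (hw.memLp_weakPartial j) Set.inter_subset_left) MemLp.zero' h1
    rw [EventuallyEq, ae_restrict_iff' hV'.measurableSet] at h3
    refine (ae_restrict_iff' (isOpen_tube Ω δ).measurableSet).2 ?_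
    filter_upwards [h3] with x hx hxV hxd
    exact hx ⟨hxV, hxd⟩
  rw [integral_smul_indicator hT, integral_smul_indicator hT, ← tube_eq]
  have hl : ∫ x in tube Ω δ, partialDeriv j (fun x => φ x * cutoff Ω a b x) x • w x
      = ∫ x in tube Ω δ, partialDeriv j φ x • w x := by
    refine setIntegral_congr_fun (isOpen_tube Ω δ).measurableSet fun x hx => ?_
    rcases lt_or_ge δ' (Metric.infDist x (frontier Ω)) with h | h
    · simp [h0 x hx h]
    · have : (fun x => φ x * cutoff Ω a b x) =ᶠ[𝓝 x] φ := by
        filter_upwards [(isOpen_nearBoundary Ω a).mem_nhds (h.trans_lt ha1)] with y hy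
        rw [cutoff_eq_one ha2 (le_of_lt hy), mul_one]
      simp only [partialDeriv, this.fderiv_eq]
  have hr : ∫ x in tube Ω δ, (φ x * cutoff Ω a b x) • weakPartial (tube Ω δ) j w x
      = ∫ x in tube Ω δ, φ x • weakPartial (tube Ω δ) j w x := by
    refine integral_congr_ae ?_
    filter_upwards [hz] with x hx
    rcases lt_or_ge δ' (Metric.infDist x (frontier Ω)) with h | h
    · simp [hx h]
    · rw [cutoff_eq_one ha2 (h.trans ha1.le), mul_one]
  rw [hl, hr] at key
  exact key

lemma VanishesOnOuterBoundary.extendsByZero {δ : ℝ} {u : Space → Spinor}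
    (h : VanishesOnOuterBoundary Ω δ u) (hu : MemH1 (tube Ω δ) u) :
    ExtendsByZero (exterior Ω) (nearBoundary Ω δ) u := by
  obtain ⟨w, hw, hlim⟩ := h
  refine ExtendsByZero.of_tendsto (φ := w) hlim (isOpen_nearBoundary Ω δ).measurableSet
    (fun n => (hw n).1) hu fun n => ?_
  obtain ⟨δ', hδ', h0⟩ := (hw n).2
  exact extendsByZero_of_vanishing hδ' (hw n).1 h0

lemma infDist_eq_zero_of_mem {x : Space} (hx : x ∈ frontier Ω) :
    Metric.infDist x (frontier Ω) = 0 := Metric.infDist_zero_of_mem hx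

/-- Extension by zero maps `V_{v,δ}` to `V_v`. -/
lemma indicator_mem_admissible {δ : ℝ} (hδ : 0 < δ) {u v : Space → Spinor}
    (hu : u ∈ admissibleTube Ω δ v) :
    (nearBoundary Ω δ).indicator u ∈ admissible Ω v := by
  obtain ⟨huH, ⟨g, ⟨hg, φ, hφ, hlim, htr⟩, hgv⟩, hvan⟩ := hu
  have hT := (isOpen_nearBoundary Ω δ).measurableSet
  have hU := isOpen_exterior Ω
  have hV := isOpen_tube Ω δ
  have hext := hvan.extendsByZero huH
  have hE := hext.memH1 hT huH
  refine ⟨hE, g, ⟨hg, ?_⟩, hgv⟩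
  have hab : δ / 3 < δ / 2 := by linarith
  have hψ := isMultiplier_cutoff (Ω := Ω) hab
  set ψ := cutoff Ω (δ / 3) (δ / 2) with hψdef
  have hvan' : ∀ f : Space → Spinor, MemH1 (tube Ω δ) f →
      ExtendsByZero (exterior Ω) (nearBoundary Ω δ) fun x => ψ x • f x := fun f hf =>
    extendsByZero_of_vanishing (δ' := δ / 2) (by linarith) (hf.smul hV hψ) fun x _ hx => by
      rw [hψdef, cutoff_eq_zero hab hx.le, zero_smul]
  have hφs : ∀ n, MemH1 (tube Ω δ) fun x => ψ x • φ n x := fun n => (hφ n).1.smul hV hψ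
  have hus : MemH1 (tube Ω δ) fun x => ψ x • u x := huH.smul hV hψ
  have hrest := hE.smul hU hψ.one_sub
  have hφe := fun n => (hvan' _ (hφ n).1).memH1 hT (hφs n)
  have hue := (hvan' _ huH).memH1 hT hus
  have hnear : ∀ n, ∀ x, Metric.infDist x (frontier Ω) < δ / 3 →
      ((nearBoundary Ω δ).indicator (fun x => ψ x • φ n x)
        + fun x => (1 - ψ x) • (nearBoundary Ω δ).indicator u x) x = φ n x := by
    intro n x hx
    have hx' : x ∈ nearBoundary Ω δ := lt_trans hx (by linarith)
    have h1 : ψ x = 1 := cutoff_eq_one hab hx.le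
    simp [hx', h1]
  -- The functions `φ n` approximating the trace need not vanish at the outer boundary. They are
  -- therefore used only near `Γ` and glued to the extended `u` farther out. The glued functions
  -- equal `φ n` near `Γ` and converge to `ψu + (1-ψ)u = u`.
  refine ⟨fun n => (nearBoundary Ω δ).indicator (fun x => ψ x • φ n x)
    + fun x => (1 - ψ x) • (nearBoundary Ω δ).indicator u x, fun n =>
    ⟨(hφe n).add hrest, ?_⟩, ?_, htr.congr fun n => eLpNorm_congr_ae ?_⟩
  · obtain ⟨W, hW, hΓW, hc⟩ := (hφ n).2
    refine ⟨W ∩ nearBoundary Ω (δ / 3), hW.inter (isOpen_nearBoundary _ _), fun x hx =>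
      ⟨hΓW hx, (infDist_eq_zero_of_mem hx).trans_lt (by positivity)⟩, ?_⟩
    refine (hc.mono ?_).congr fun x hx => hnear n x hx.2.2
    rintro x ⟨hx1, hx2, hx3⟩
    refine ⟨hx1.imp (fun h => ⟨h, lt_trans hx3 (by linarith)⟩) id, hx2⟩
  · have h1 := TendstoH1.indicator (U := exterior Ω) (T := nearBoundary Ω δ)
      (hlim.smul hV (fun n => (hφ n).1) huH hψ) hU hT hφs hus (fun n => hvan' _ (hφ n).1)
      (hvan' _ huH)
    refine (h1.add_const hU hφe hue hrest).congr_limit hU (hue.add hrest)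
      (Eventually.of_forall fun x => ?_)
    by_cases hx : x ∈ nearBoundary Ω δ
    · simp [hx, ← add_smul]
    · simp [hx]
  · filter_upwards [ae_restrict_mem isClosed_frontier.measurableSet] with x hx
    have := hnear n x (by rw [infDist_eq_zero_of_mem hx]; positivity)
    simp only [Pi.sub_apply, this]

/-- Multiplication by a function equal to `1` on the boundary preserves `V_v`. -/
lemma smul_mem_admissible {u v : Space → Spinor} (hu : u ∈ admissible Ω v) {ψ : Space → ℝ}
    (hψ : IsMultiplier ψ) (h1 : ∀ x ∈ frontier Ω, ψ x = 1) :
    (fun x => ψ x • u x) ∈ admissible Ω v := by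
  obtain ⟨huH, g, hg, hgv⟩ := hu
  exact ⟨huH.smul (isOpen_exterior Ω) hψ, g, hg.smul (isOpen_exterior Ω)
    isClosed_frontier.measurableSet huH hψ h1, hgv⟩

/-- Cutting off maps `V_v` to `V_{v,δ}`. -/
lemma cutoff_smul_mem_admissibleTube {δ : ℝ} (ha : 0 ≤ a) (hab : a < b) (hb : b < δ)
    {u v : Space → Spinor} (hu : u ∈ admissible Ω v) :
    (fun x => cutoff Ω a b x • u x) ∈ admissibleTube Ω δ v := by
  have hψ := isMultiplier_cutoff (Ω := Ω) hab
  obtain ⟨hH, g, hg, hgv⟩ := smul_mem_admissible hu hψ fun x hx =>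
    cutoff_eq_one hab (by rwa [infDist_eq_zero_of_mem hx])
  -- hH.mono and the trace restrict to the tube; the cut off function already vanishes beyond `b <
  -- δ`, so the constant sequence witnesses the outer condition.
  have hsub := tube_subset_exterior Ω δ
  refine ⟨hH.mono hsub, ⟨g, hg.mono (isOpen_tube Ω δ) hsub hH, hgv⟩, fun _ => _, fun _ =>
    ⟨hH.mono hsub, b, hb, fun x _ hx => ?_⟩, tendstoH1_const _⟩
  simp only [cutoff_eq_zero hab hx.le, zero_smul]

lemma energy_nonneg (U : Set Space) (m : ℝ) (u : Space → Spinor) : 0 ≤ energy U m u := by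
  unfold energy
  positivity

lemma Lam_nonneg (Ω : Set Space) (m : ℝ) (v : Space → Spinor) : 0 ≤ Lam Ω m v :=
  Real.sInf_nonneg (by rintro _ ⟨u, _, rfl⟩; exact energy_nonneg _ _ _)

lemma LamTube_nonneg (Ω : Set Space) (m δ : ℝ) (v : Space → Spinor) : 0 ≤ LamTube Ω m δ v :=
  Real.sInf_nonneg (by rintro _ ⟨u, _, rfl⟩; exact energy_nonneg _ _ _)

lemma bddBelow_energy (U : Set Space) (m : ℝ) (S : Set (Space → Spinor)) :
    BddBelow (energy U m '' S) :=
  ⟨0, by rintro _ ⟨u, _, rfl⟩; exact energy_nonneg _ _ _⟩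

lemma admissibleTube_nonempty {δ : ℝ} (hδ : 0 < δ) {v : Space → Spinor}
    (h : (admissible Ω v).Nonempty) : (admissibleTube Ω δ v).Nonempty :=
  let ⟨_, hu⟩ := h
  ⟨_, cutoff_smul_mem_admissibleTube (a := δ / 3) (b := δ / 2) (by linarith) (by linarith)
    (by linarith) hu⟩

theorem Lam_le_LamTube {δ : ℝ} (hδ : 0 < δ) (m : ℝ) (v : Space → Spinor) :
    Lam Ω m v ≤ LamTube Ω m δ v := by
  rcases (admissible Ω v).eq_empty_or_nonempty with h | h
  -- If `V_v` is empty, its real infimum is 0 by convention.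
  · refine le_of_eq_of_le ?_ (LamTube_nonneg Ω m δ v)
    simp [Lam, h]
  · refine le_csInf ((admissibleTube_nonempty hδ h).image _) ?_
    rintro _ ⟨u, hu, rfl⟩
    refine csInf_le (bddBelow_energy _ _ _) ⟨_, indicator_mem_admissible hδ hu, ?_⟩
    exact energy_indicator (hu.2.2.extendsByZero hu.1) (isOpen_exterior Ω)
      (isOpen_nearBoundary Ω δ).measurableSet hu.1 m

end Cutoff

/-! ### Exponential multipliers and energy identities. -/

namespace IsMultiplier

variable {ψ : Space → ℝ}

lemma sub_one (h : IsMultiplier ψ) : IsMultiplier fun x => ψ x - 1 := by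
  simpa [sub_eq_add_neg] using h.add (const (-1))

lemma abs_exp_sub_exp_le {a b M : ℝ} (ha : a ≤ M) (hb : b ≤ M) :
    |Real.exp a - Real.exp b| ≤ Real.exp M * |a - b| := by
  have key : ∀ s t : ℝ, s ≤ M → Real.exp s - Real.exp t ≤ Real.exp M * |s - t| := by
    intro s t hs
    have h1 := Real.add_one_le_exp (t - s)
    have h2 : Real.exp t = Real.exp s * Real.exp (t - s) := by rw [← Real.exp_add]; ring_nf
    calc Real.exp s - Real.exp t = Real.exp s * (1 - Real.exp (t - s)) := by rw [h2]; ring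
      _ ≤ Real.exp s * |s - t| :=
        mul_le_mul_of_nonneg_left (by linarith [le_abs_self (s - t)]) (Real.exp_pos _).le
      _ ≤ _ := mul_le_mul_of_nonneg_right (Real.exp_le_exp.2 hs) (abs_nonneg _)
  refine abs_sub_le_iff.2 ⟨key a b ha, ?_⟩
  rw [abs_sub_comm]
  exact key b a hb

lemma exp (h : IsMultiplier ψ) : IsMultiplier fun x => Real.exp (ψ x) := by
  obtain ⟨⟨K, hK⟩, M, hM⟩ := h
  have hle : ∀ x, ψ x ≤ M := fun x => (le_abs_self _).trans (hM x)
  refine ⟨⟨⟨Real.exp M, (Real.exp_pos M).le⟩ * K, LipschitzWith.of_dist_le_mul fun x y => ?_⟩,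
    Real.exp M, fun x => ?_⟩
  · have h1 := hK.dist_le_mul x y
    rw [Real.dist_eq] at h1 ⊢
    refine (abs_exp_sub_exp_le (hle x) (hle y)).trans ?_
    change _ ≤ Real.exp M * K * dist x y
    rw [mul_assoc]
    exact mul_le_mul_of_nonneg_left h1 (Real.exp_pos M).le
  · rw [abs_of_pos (Real.exp_pos _)]
    exact Real.exp_le_exp.2 (hle x)

end IsMultiplier

/-- The real part of the Hermitian product, by polarization. -/
def cross (a b : Spinor) : ℝ := (‖a + b‖ ^ 2 - ‖a‖ ^ 2 - ‖b‖ ^ 2) / 2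

lemma norm_sq_smul_add_smul (α β : ℝ) (a b : Spinor) :
    ‖α • a + β • b‖ ^ 2 = α ^ 2 * ‖a‖ ^ 2 + 2 * α * β * cross a b + β ^ 2 * ‖b‖ ^ 2 := by
  have hs : ∀ (r : ℝ) (y : Spinor), r • y = (r : ℂ) • y := fun r y => by
    ext i
    simp
  have hc : cross a b = RCLike.re (inner ℂ a b) := by
    rw [cross, norm_add_sq (𝕜 := ℂ) a b]
    ring
  rw [hc, hs, hs, norm_add_sq (𝕜 := ℂ), norm_smul, norm_smul, inner_smul_left, inner_smul_right]
  simp only [Complex.norm_real, Real.norm_eq_abs, mul_pow, sq_abs, Complex.conj_ofReal,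
    RCLike.re_to_complex, Complex.re_ofReal_mul]
  ring

section Energy

variable {U : Set Space} {m : ℝ} {u : Space → Spinor} {ψ η : Space → ℝ}

/-- The energy density of `ψ u`. -/
def energyDensity (U : Set Space) (m : ℝ) (u : Space → Spinor) (ψ : Space → ℝ) (x : Space) : ℝ :=
  (∑ j, ‖ψ x • weakPartial U j u x + partialDeriv j ψ x • u x‖ ^ 2) + m ^ 2 * ‖ψ x • u x‖ ^ 2

/-- The density of the energy form evaluated at `u` and `ψ u`. -/
def formDensity (U : Set Space) (m : ℝ) (u : Space → Spinor) (ψ : Space → ℝ) (x : Space) : ℝ :=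
  (∑ j, (ψ x * ‖weakPartial U j u x‖ ^ 2 + partialDeriv j ψ x * cross (weakPartial U j u x) (u x)))
    + m ^ 2 * (ψ x * ‖u x‖ ^ 2)

/-- The energy form evaluated at `u` and `ψ u`. -/
def energyForm (U : Set Space) (m : ℝ) (u : Space → Spinor) (ψ : Space → ℝ) : ℝ :=
  ∫ x in U, formDensity U m u ψ x

lemma integrable_norm_sq {μ : Measure Space} (hu : MemLp u 2 μ) :
    Integrable (fun x => ‖u x‖ ^ 2) μ := hu.norm.integrable_sq

lemma energyDensity_ae_eq (hU : IsOpen U) (hu : MemH1 U u) (hψ : IsMultiplier ψ) (m : ℝ) :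
    (fun x => (∑ j, ‖weakPartial U j (fun x => ψ x • u x) x‖ ^ 2) + m ^ 2 * ‖ψ x • u x‖ ^ 2)
      =ᵐ[volume.restrict U] energyDensity U m u ψ := by
  filter_upwards [ae_all_iff.2 (hu.weakPartial_smul hU hψ)] with x hx
  simp only [energyDensity, hx]

lemma integrable_energyDensity (hU : IsOpen U) (hu : MemH1 U u) (hψ : IsMultiplier ψ) (m : ℝ) :
    Integrable (energyDensity U m u ψ) (volume.restrict U) := by
  have h := hu.smul hU hψ
  refine Integrable.congr ?_ (energyDensity_ae_eq hU hu hψ m)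
  exact (integrable_finsetSum _ fun j _ => integrable_norm_sq (h.memLp_weakPartial j)).add
    ((integrable_norm_sq h.1).const_mul _)

lemma energy_smul (hU : IsOpen U) (hu : MemH1 U u) (hψ : IsMultiplier ψ) (m : ℝ) :
    energy U m (fun x => ψ x • u x) = ∫ x in U, energyDensity U m u ψ x := by
  have h := hu.smul hU hψ
  rw [← integral_congr_ae (energyDensity_ae_eq hU hu hψ m),
    integral_add (integrable_finsetSum _ fun j _ => integrable_norm_sq (h.memLp_weakPartial j))
    ((integrable_norm_sq h.1).const_mul _), integral_finsetSum _ fun j _ =>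
      integrable_norm_sq (h.memLp_weakPartial j), integral_const_mul]
  rfl

lemma energyDensity_one (U : Set Space) (m : ℝ) (u : Space → Spinor) (x : Space) :
    energyDensity U m u (fun _ => 1) x
      = (∑ j, ‖weakPartial U j u x‖ ^ 2) + m ^ 2 * ‖u x‖ ^ 2 := by
  simp [energyDensity, partialDeriv]

lemma energy_eq_integral_density (hU : IsOpen U) (hu : MemH1 U u) (m : ℝ) :
    energy U m u = ∫ x in U, energyDensity U m u (fun _ => 1) x := by
  simpa using energy_smul hU hu (IsMultiplier.const 1) m

lemma partialDeriv_one_add_smul (t : ℝ) (ψ : Space → ℝ) (j : Fin 3) (x : Space) :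
    partialDeriv j (fun x => 1 + t * ψ x) x = t * partialDeriv j ψ x := by
  have h : (fun x => t * ψ x) = t • ψ := rfl
  simp [partialDeriv, fderiv_const_add, h, fderiv_const_smul_field]

/-- Pointwise expansion of a square. It holds even where `ψ` is not differentiable, since the
default derivative 0 scales correctly. It identifies `formDensity` as half the linear coefficient in
`t`, that is, as the density of the first variation. -/
lemma energyDensity_one_add_smul (U : Set Space) (m t : ℝ) (u : Space → Spinor) (ψ : Space → ℝ)
    (x : Space) : energyDensity U m u (fun x => 1 + t * ψ x) x
      = energyDensity U m u (fun _ => 1) x + 2 * t * formDensity U m u ψ x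
        + t ^ 2 * energyDensity U m u ψ x := by
  rw [energyDensity_one]
  simp only [energyDensity, formDensity, partialDeriv_one_add_smul, norm_sq_smul_add_smul,
    norm_smul, mul_pow, Real.norm_eq_abs, sq_abs, Fin.sum_univ_three]
  ring

lemma integrable_formDensity (hU : IsOpen U) (hu : MemH1 U u) (hψ : IsMultiplier ψ) (m : ℝ) :
    Integrable (formDensity U m u ψ) (volume.restrict U) := by
  -- At `t = 1` the expansion expresses `formDensity` through three integrable energy densities.
  have h1 := integrable_energyDensity hU hu ((IsMultiplier.const 1).add (hψ.smul 1)) m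
  have h2 := integrable_energyDensity hU hu (IsMultiplier.const 1) m
  have h3 := integrable_energyDensity hU hu hψ m
  refine (((h1.sub h2).sub h3).const_mul (1 / 2)).congr (Eventually.of_forall fun x => ?_)
  simp only [Pi.sub_apply, energyDensity_one_add_smul]
  ring

lemma energy_one_add_smul (hU : IsOpen U) (hu : MemH1 U u) (hψ : IsMultiplier ψ) (m t : ℝ) :
    energy U m (fun x => (1 + t * ψ x) • u x)
      = energy U m u + 2 * t * energyForm U m u ψ + t ^ 2 * energy U m (fun x => ψ x • u x) := by
  rw [energy_smul hU hu ((IsMultiplier.const 1).add (hψ.smul t)), energy_smul hU hu hψ,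
    energy_eq_integral_density hU hu, energyForm, ← integral_const_mul, ← integral_const_mul]
  have h2 := integrable_energyDensity hU hu (IsMultiplier.const 1) m
  have h3 := (integrable_energyDensity hU hu hψ m).const_mul (t ^ 2)
  have h4 := (integrable_formDensity hU hu hψ m).const_mul (2 * t)
  have h5 : Integrable (fun x => energyDensity U m u (fun _ => 1) x
    + 2 * t * formDensity U m u ψ x) (volume.restrict U) := h2.add h4
  rw [← integral_add h2 h4, ← integral_add h5 h3]
  exact integral_congr_ae (Eventually.of_forall fun x =>
    energyDensity_one_add_smul U m t u ψ x)

/-- The cross terms agree because `∂(η²) = 2η ∂η`, so only `|∇η|²|u|²` is left over. The chain rule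
requires differentiability of `η`, hence the almost everywhere statement. -/
lemma energyDensity_ae_eq_formDensity_sq (hη : IsMultiplier η) :
    energyDensity U m u η =ᵐ[volume.restrict U] fun x => formDensity U m u (fun x => η x ^ 2) x
      + (∑ j, partialDeriv j η x ^ 2) * ‖u x‖ ^ 2 := by
  filter_upwards [hη.ae_differentiableAt U] with x hx
  have h : ∀ j, partialDeriv j (fun x => η x ^ 2) x = 2 * η x * partialDeriv j η x := fun j => by
    simp only [pow_two, IsMultiplier.partialDeriv_mul hx hx]
    ring
  simp only [energyDensity, formDensity, h, norm_sq_smul_add_smul,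
    norm_smul, mul_pow, Real.norm_eq_abs, sq_abs, Fin.sum_univ_three]
  ring

lemma integrable_sum_sq_partialDeriv (hU : IsOpen U) (hu : MemH1 U u) (hη : IsMultiplier η) :
    Integrable (fun x => (∑ j, partialDeriv j η x ^ 2) * ‖u x‖ ^ 2) (volume.restrict U) := by
  refine ((integrable_energyDensity hU hu hη 0).sub
    (integrable_formDensity hU hu hη.sq 0)).congr ?_
  filter_upwards [energyDensity_ae_eq_formDensity_sq (U := U) (m := 0) (u := u) hη] with x hx
  rw [Pi.sub_apply, hx]
  ring

/-- The IMS localization formula. -/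
lemma energy_smul_eq (hU : IsOpen U) (hu : MemH1 U u) (hη : IsMultiplier η) (m : ℝ) :
    energy U m (fun x => η x • u x) = energyForm U m u (fun x => η x ^ 2)
      + ∫ x in U, (∑ j, partialDeriv j η x ^ 2) * ‖u x‖ ^ 2 := by
  rw [energy_smul hU hu hη, integral_congr_ae (energyDensity_ae_eq_formDensity_sq hη), energyForm]
  exact integral_add (integrable_formDensity hU hu hη.sq m)
    (integrable_sum_sq_partialDeriv hU hu hη)

/-- The form is affine in `ψ`. For `ψ = 1` on `Γ`, the remainder `ψ - 1` vanishes there and is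
controlled by the first variation. -/
lemma energyForm_eq (hU : IsOpen U) (hu : MemH1 U u) (hψ : IsMultiplier ψ) (m : ℝ) :
    energyForm U m u ψ = energy U m u + energyForm U m u fun x => ψ x - 1 := by
  rw [energy_eq_integral_density hU hu, energyForm, energyForm,
    ← integral_add (integrable_energyDensity hU hu (IsMultiplier.const 1) m)
      (integrable_formDensity hU hu hψ.sub_one m)]
  refine integral_congr_ae (Eventually.of_forall fun x => ?_)
  have h : ∀ j, partialDeriv j (fun x => ψ x - 1) x = partialDeriv j ψ x := fun j => by
    simp [partialDeriv, fderiv_sub_const]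
  simp only [energyDensity_one, formDensity, h, Fin.sum_univ_three]
  ring

/-- The constant does not depend on `u`, so errors bounded through it disappear as `ε → 0`, whatever
its size. Its second term absorbs three derivatives, each contributing `2K²|u|²`, into the mass
term. -/
lemma exists_energy_smul_le (hψ : IsMultiplier ψ) {m : ℝ} (hm : 0 < m) :
    ∃ C : ℝ, 0 ≤ C ∧ ∀ {U : Set Space} {u : Space → Spinor}, IsOpen U → MemH1 U u →
      energy U m (fun x => ψ x • u x) ≤ C * energy U m u := by
  obtain ⟨⟨K, hK⟩, M, hM⟩ := id hψ
  refine ⟨2 * M ^ 2 + 6 * (K : ℝ) ^ 2 / m ^ 2, by positivity, fun {U u} hU hu => ?_⟩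
  rw [energy_smul hU hu hψ, energy_eq_integral_density hU hu, ← integral_const_mul]
  refine integral_mono (integrable_energyDensity hU hu hψ m)
    ((integrable_energyDensity hU hu (IsMultiplier.const 1) m).const_mul _) fun x => ?_
  have h1 : ψ x ^ 2 ≤ M ^ 2 := sq_le_sq' (abs_le.1 (hM x)).1 (abs_le.1 (hM x)).2
  have h2 : ∀ j, partialDeriv j ψ x ^ 2 ≤ (K : ℝ) ^ 2 := fun j =>
    sq_le_sq' (abs_le.1 (abs_partialDeriv_le hK j x)).1 (abs_le.1 (abs_partialDeriv_le hK j x)).2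
  have h3 : ∀ j, ‖ψ x • weakPartial U j u x + partialDeriv j ψ x • u x‖ ^ 2
      ≤ 2 * M ^ 2 * ‖weakPartial U j u x‖ ^ 2 + 2 * (K : ℝ) ^ 2 * ‖u x‖ ^ 2 := fun j => by
    have h4 := pow_le_pow_left₀ (norm_nonneg _)
      (norm_add_le (ψ x • weakPartial U j u x) (partialDeriv j ψ x • u x)) 2
    have h5 := add_sq_le (a := ‖ψ x • weakPartial U j u x‖) (b := ‖partialDeriv j ψ x • u x‖)
    rw [norm_smul, norm_smul, mul_pow, mul_pow, Real.norm_eq_abs, Real.norm_eq_abs, sq_abs,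
      sq_abs] at h5
    have h6 := mul_le_mul_of_nonneg_right h1 (sq_nonneg ‖weakPartial U j u x‖)
    have h7 := mul_le_mul_of_nonneg_right (h2 j) (sq_nonneg ‖u x‖)
    rw [norm_smul, norm_smul, Real.norm_eq_abs, Real.norm_eq_abs] at h4
    linarith
  have h8 : ‖ψ x • u x‖ ^ 2 ≤ M ^ 2 * ‖u x‖ ^ 2 := by
    rw [norm_smul, mul_pow, Real.norm_eq_abs, sq_abs]
    exact mul_le_mul_of_nonneg_right h1 (sq_nonneg _)
  rw [energyDensity_one, energyDensity]
  have h9 := Finset.sum_le_sum (s := Finset.univ) fun j _ => h3 j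
  rw [Finset.sum_add_distrib, ← Finset.mul_sum, Finset.sum_const, Finset.card_univ,
    Fintype.card_fin, nsmul_eq_mul] at h9
  have h10 := mul_le_mul_of_nonneg_left h8 (sq_nonneg m)
  have h11 : 0 ≤ 6 * (K : ℝ) ^ 2 / m ^ 2 * ∑ j, ‖weakPartial U j u x‖ ^ 2 := by positivity
  have h12 : 6 * (K : ℝ) ^ 2 / m ^ 2 * (m ^ 2 * ‖u x‖ ^ 2) = 6 * (K : ℝ) ^ 2 * ‖u x‖ ^ 2 := by
    field_simp
  have h13 : 0 ≤ M ^ 2 * (m ^ 2 * ‖u x‖ ^ 2) := by positivity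
  push_cast at h9
  rw [add_mul, mul_add, mul_add, h12]
  linarith

lemma mul_integral_norm_sq_le_energy (U : Set Space) (m : ℝ) (u : Space → Spinor) :
    m ^ 2 * ∫ x in U, ‖u x‖ ^ 2 ≤ energy U m u := by
  have : 0 ≤ ∑ j : Fin 3, ∫ x in U, ‖weakPartial U j u x‖ ^ 2 := by positivity
  unfold energy
  linarith

lemma energy_mono {V : Set Space} (hV : IsOpen V) (hVU : V ⊆ U) (hu : MemH1 U u) (m : ℝ) :
    energy V m u ≤ energy U m u := by
  have h : ∀ f : Space → Spinor, MemLp f 2 (volume.restrict U) →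
      ∫ x in V, ‖f x‖ ^ 2 ≤ ∫ x in U, ‖f x‖ ^ 2 := fun f hf =>
    setIntegral_mono_set (integrable_norm_sq hf) (Eventually.of_forall fun x => sq_nonneg _)
      (Eventually.of_forall hVU)
  unfold energy
  refine add_le_add (Finset.sum_le_sum fun j _ => ?_)
    (mul_le_mul_of_nonneg_left (h u hu.1) (sq_nonneg m))
  refine le_of_eq_of_le (integral_congr_ae ?_) (h _ (hu.memLp_weakPartial j))
  filter_upwards [hu.weakPartial_mono hV hVU j] with x hx
  rw [hx]

end Energy

/-! ### First variation and Agmon estimate. -/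

section Agmon

variable {Ω : Set Space} {m γ ε : ℝ} {u v : Space → Spinor}

/-- The first variation at an almost minimizer. -/
lemma abs_energyForm_le (hu : u ∈ admissible Ω v)
    (hmin : ∀ w ∈ admissible Ω v, energy (exterior Ω) m u ≤ energy (exterior Ω) m w + ε)
    {ψ : Space → ℝ} (hψ : IsMultiplier ψ) (h0 : ∀ x ∈ frontier Ω, ψ x = 0) :
    |energyForm (exterior Ω) m u ψ|
      ≤ Real.sqrt (ε * energy (exterior Ω) m fun x => ψ x • u x) := by
  refine Real.abs_le_sqrt ?_
  -- Each `(1 + tψ)u` is a competitor because `ψ = 0` on `Γ`. A quadratic polynomial in `t` that is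
  -- nonnegative everywhere has nonpositive discriminant.
  have h : ∀ t : ℝ, 0 ≤ energy (exterior Ω) m (fun x => ψ x • u x) * (t * t)
      + 2 * energyForm (exterior Ω) m u ψ * t + ε := by
    intro t
    have h1 := hmin _ (smul_mem_admissible hu ((IsMultiplier.const 1).add (hψ.smul t))
      fun x hx => by simp [h0 x hx])
    rw [energy_one_add_smul (isOpen_exterior Ω) hu.1 hψ] at h1
    linarith
  have h2 := discrim_le_zero h
  rw [discrim] at h2
  linarith

/-- The truncated exponential weight. -/
def weight (Ω : Set Space) (s R : ℝ) (x : Space) : ℝ :=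
  Real.exp (s * min (Metric.infDist x (frontier Ω)) R)

lemma lipschitzWith_min_infDist (Ω : Set Space) (R : ℝ) :
    LipschitzWith 1 fun x : Space => min (Metric.infDist x (frontier Ω)) R :=
  (Metric.lipschitz_infDist_pt (frontier Ω)).min_const R

lemma isMultiplier_weight (Ω : Set Space) (s : ℝ) {R : ℝ} (hR : 0 ≤ R) :
    IsMultiplier (weight Ω s R) := by
  have h : IsMultiplier fun x : Space => min (Metric.infDist x (frontier Ω)) R :=
    ⟨⟨1, lipschitzWith_min_infDist Ω R⟩, R, fun x => by
      rw [abs_of_nonneg (le_min Metric.infDist_nonneg hR)]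
      exact min_le_right _ _⟩
  exact (h.smul s).exp

/-- The truncated distance is 1-Lipschitz, so the chain rule gives `|∇q| ≤ s q` for the weight `q`.
-/
lemma sum_sq_partialDeriv_weight_le (Ω : Set Space) {s R : ℝ} (hs : 0 ≤ s) (U : Set Space) :
    ∀ᵐ x ∂(volume.restrict U),
      ∑ j, partialDeriv j (fun x => weight Ω s R x - 1) x ^ 2 ≤ s ^ 2 * weight Ω s R x ^ 2 := by
  filter_upwards [ae_restrict_of_ae (lipschitzWith_min_infDist Ω R).ae_differentiableAt] with x hx
  refine (sum_sq_partialDeriv_le _ x).trans ?_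
  have h1 : HasFDerivAt (fun x => weight Ω s R x - 1) (weight Ω s R x •
      (s • fderiv ℝ (fun x : Space => min (Metric.infDist x (frontier Ω)) R) x)) x :=
    ((hx.hasFDerivAt.const_mul s).exp).sub_const 1
  have hw : 0 < weight Ω s R x := Real.exp_pos _
  have h2 := norm_fderiv_le_of_lipschitz ℝ (lipschitzWith_min_infDist Ω R) (x₀ := x)
  rw [h1.fderiv, norm_smul, norm_smul, Real.norm_eq_abs, Real.norm_eq_abs, abs_of_pos hw,
    abs_of_nonneg hs, ← mul_pow]
  refine pow_le_pow_left₀ (by positivity) ?_ 2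
  rw [mul_comm s (weight Ω s R x)]
  refine mul_le_mul_of_nonneg_left ?_ hw.le
  simpa using mul_le_mul_of_nonneg_left h2 hs

/-- The Agmon estimate for almost minimizers. -/
lemma exists_agmon (Ω : Set Space) (hm : 0 < m) (hγ₀ : 0 < γ) (hγ₁ : γ < 1) {R : ℝ} (hR : 0 ≤ R) :
    ∃ C : ℝ, 0 ≤ C ∧ ∀ {u v : Space → Spinor} {ε : ℝ}, 0 ≤ ε → u ∈ admissible Ω v →
      (∀ w ∈ admissible Ω v, energy (exterior Ω) m u ≤ energy (exterior Ω) m w + ε) →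
      ∫ x in exterior Ω, weight Ω (m * γ) R x ^ 2 * ‖u x‖ ^ 2
        ≤ 1 / (1 - γ) ^ 2 * (∫ x in exterior Ω, ‖u x‖ ^ 2)
          + C * Real.sqrt (ε * energy (exterior Ω) m u) := by
  have hq := isMultiplier_weight Ω (m * γ) hR
  -- Subtracting 1 makes the weight vanish on `Γ`, as the first variation requires.
  have hη := hq.sub_one
  have hγ' : 0 < 1 - γ := sub_pos.2 hγ₁
  obtain ⟨C, hC, hCb⟩ := exists_energy_smul_le hη.sq hm
  refine ⟨Real.sqrt C / (m ^ 2 * γ * (1 - γ)), by positivity, fun {u v ε} hε hu hmin => ?_⟩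
  have hU := isOpen_exterior Ω
  have h0 : ∀ x ∈ frontier Ω, weight Ω (m * γ) R x - 1 = 0 := fun x hx => by
    simp [weight, infDist_eq_zero_of_mem hx, hR]
  have hint : ∀ {χ : Space → ℝ}, IsMultiplier χ →
      Integrable (fun x => χ x ^ 2 * ‖u x‖ ^ 2) (volume.restrict (exterior Ω)) := by
    intro χ hχ
    refine (integrable_norm_sq (hχ.memLp_smul hu.1.1)).congr (Eventually.of_forall fun x => ?_)
    simp only [norm_smul, mul_pow, Real.norm_eq_abs, sq_abs]
  set X := ∫ x in exterior Ω, (weight Ω (m * γ) R x - 1) ^ 2 * ‖u x‖ ^ 2 with hX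
  set Y := ∫ x in exterior Ω, ‖u x‖ ^ 2 with hY
  set Q := ∫ x in exterior Ω, weight Ω (m * γ) R x ^ 2 * ‖u x‖ ^ 2 with hQ
  set τ := Real.sqrt (ε * energy (exterior Ω) m u) with hτ
  have hform := (le_abs_self _).trans (abs_energyForm_le hu hmin hη.sq
    (fun x hx => by rw [h0 x hx]; norm_num))
  have hτ' : Real.sqrt (ε * energy (exterior Ω) m
      fun x => (weight Ω (m * γ) R x - 1) ^ 2 • u x) ≤ Real.sqrt C * τ := by
    rw [hτ, ← Real.sqrt_mul hC]
    refine Real.sqrt_le_sqrt ?_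
    have := mul_le_mul_of_nonneg_left (hCb hU hu.1) hε
    linarith
  have h1 : m ^ 2 * X ≤ Real.sqrt C * τ + (m * γ) ^ 2 * Q := by
    have h2 := mul_integral_norm_sq_le_energy (exterior Ω) m
      fun x => (weight Ω (m * γ) R x - 1) • u x
    simp only [norm_smul, mul_pow, Real.norm_eq_abs, sq_abs] at h2
    rw [energy_smul_eq hU hu.1 hη] at h2
    have h3 : ∫ x in exterior Ω, (∑ j, partialDeriv j (fun x => weight Ω (m * γ) R x - 1) x ^ 2)
        * ‖u x‖ ^ 2 ≤ (m * γ) ^ 2 * Q := by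
      rw [hQ, ← integral_const_mul]
      refine integral_mono_ae (integrable_sum_sq_partialDeriv hU hu.1 hη)
        ((hint hq).const_mul _) ?_
      filter_upwards [sum_sq_partialDeriv_weight_le Ω (s := m * γ) (R := R) (by positivity)
        (exterior Ω)] with x hx
      rw [← mul_assoc]
      exact mul_le_mul_of_nonneg_right hx (sq_nonneg _)
    linarith
  have h4 : Q ≤ X / γ + Y / (1 - γ) := by
    rw [hQ, hX, hY, ← integral_div, ← integral_div,
      ← integral_add ((hint hη).div_const _) ((integrable_norm_sq hu.1.1).div_const _)]
    refine integral_mono (hint hq) (((hint hη).div_const _).add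
      ((integrable_norm_sq hu.1.1).div_const _)) fun x => ?_
    -- Weighted Young inequality for `(η + 1)²`. The weight `1/γ` turns the factor `γ²` in front of
    -- `Q` into `γ < 1` in front of `X`, which can be absorbed on the left.
    have h5 : weight Ω (m * γ) R x ^ 2
        ≤ (weight Ω (m * γ) R x - 1) ^ 2 / γ + 1 / (1 - γ) := by
      set η := weight Ω (m * γ) R x - 1 with hηd
      have h6 : weight Ω (m * γ) R x = η + 1 := by rw [hηd]; ring
      have h7 : η ^ 2 / γ + 1 / (1 - γ) - (η + 1) ^ 2
          = ((1 - γ) * η - γ) ^ 2 / (γ * (1 - γ)) := by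
        field_simp
        ring
      have h8 : 0 ≤ ((1 - γ) * η - γ) ^ 2 / (γ * (1 - γ)) := by positivity
      rw [h6]
      linarith
    have h9 := mul_le_mul_of_nonneg_right h5 (sq_nonneg ‖u x‖)
    refine h9.trans (le_of_eq ?_)
    ring
  have h10 : m ^ 2 * X * (1 - γ) ≤ Real.sqrt C * τ + m ^ 2 * γ ^ 2 * Y / (1 - γ) := by
    have h11 := mul_le_mul_of_nonneg_left h4 (sq_nonneg (m * γ))
    have h12 : (m * γ) ^ 2 * (X / γ + Y / (1 - γ))
        = m ^ 2 * X * γ + m ^ 2 * γ ^ 2 * Y / (1 - γ) := by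
      field_simp
    linarith
  have h13 : X / γ ≤ (Real.sqrt C * τ + m ^ 2 * γ ^ 2 * Y / (1 - γ)) / (m ^ 2 * γ * (1 - γ)) := by
    rw [le_div_iff₀ (by positivity)]
    refine le_of_eq_of_le ?_ h10
    field_simp
  refine h4.trans ((add_le_add_left h13 _).trans (le_of_eq ?_))
  field_simp
  ring

end Agmon

/-! ### Decay of minimizers and comparison of the two infima. -/

section Main

variable {Ω : Set Space} {m γ : ℝ} {u v : Space → Spinor}

/-- The exponential decay of minimizers. -/
theorem lintegral_exp_smul_le (hm : 0 < m) (hγ₀ : 0 < γ) (hγ₁ : γ < 1)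
    (hu : IsMinimizer Ω m v u) :
    (∫⁻ x in exterior Ω, ‖Real.exp (m * γ * Metric.infDist x (frontier Ω)) • u x‖ₑ ^ 2)
      ≤ ENNReal.ofReal (1 / (1 - γ) ^ 2) * ∫⁻ x in exterior Ω, ‖u x‖ₑ ^ 2 := by
  have hconv : ∀ {f : Space → Spinor}, MemLp f 2 (volume.restrict (exterior Ω)) →
      ∫⁻ x in exterior Ω, ‖f x‖ₑ ^ 2 = ENNReal.ofReal (∫ x in exterior Ω, ‖f x‖ ^ 2) := by
    intro f hf
    rw [ofReal_integral_eq_lintegral_ofReal (integrable_norm_sq hf)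
      (Eventually.of_forall fun x => sq_nonneg _)]
    refine lintegral_congr fun x => ?_
    rw [ENNReal.ofReal_pow (norm_nonneg _), ofReal_norm]
  have hUL := hu.1.1.1
  -- For a minimizer `ε = 0` removes the only term depending on the truncation level, and monotone
  -- convergence applies with no prior integrability.
  have hbound : ∀ n : ℕ, ∫⁻ x in exterior Ω, ‖weight Ω (m * γ) n x • u x‖ₑ ^ 2
      ≤ ENNReal.ofReal (1 / (1 - γ) ^ 2) * ∫⁻ x in exterior Ω, ‖u x‖ₑ ^ 2 := by
    intro n
    obtain ⟨C, -, hC⟩ := exists_agmon Ω hm hγ₀ hγ₁ n.cast_nonneg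
    have h1 := hC le_rfl hu.1 (fun w hw => by simpa using hu.2 w hw)
    rw [zero_mul, Real.sqrt_zero, mul_zero, add_zero] at h1
    rw [hconv ((isMultiplier_weight Ω (m * γ) n.cast_nonneg).memLp_smul hUL), hconv hUL,
      ← ENNReal.ofReal_mul (by positivity)]
    refine ENNReal.ofReal_le_ofReal (le_of_eq_of_le (integral_congr_ae ?_) h1)
    exact Eventually.of_forall fun x => by
      simp only [norm_smul, mul_pow, Real.norm_eq_abs, sq_abs]
  refine le_of_tendsto' (lintegral_tendsto_of_tendsto_of_monotone (fun n => ?_) ?_ ?_) hbound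
  · exact ((isMultiplier_weight Ω (m * γ) n.cast_nonneg).memLp_smul hUL).1.enorm.pow_const 2
  · refine Eventually.of_forall fun x n k hnk => ?_
    have hnk' : (n : ℝ) ≤ k := by exact_mod_cast hnk
    have h1 : weight Ω (m * γ) n x ≤ weight Ω (m * γ) k x :=
      Real.exp_le_exp.2 (mul_le_mul_of_nonneg_left (min_le_min_left _ hnk') (by positivity))
    simp only [enorm_smul]
    gcongr
    have h2 : ∀ k : ℕ, 0 ≤ weight Ω (m * γ) k x := fun k => (Real.exp_pos _).le
    rw [Real.enorm_eq_ofReal (h2 n), Real.enorm_eq_ofReal (h2 k)]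
    exact ENNReal.ofReal_le_ofReal h1
  · refine Eventually.of_forall fun x => tendsto_const_nhds.congr' ?_
    obtain ⟨N, hN⟩ := exists_nat_ge (Metric.infDist x (frontier Ω))
    filter_upwards [eventually_ge_atTop N] with n hn
    have hn' : (N : ℝ) ≤ n := by exact_mod_cast hn
    rw [weight, min_eq_left (hN.trans hn')]

/-- The energy of a cut off almost minimizer. -/
lemma exists_LamTube_le (Ω : Set Space) (hm : 0 < m) (hγ₀ : 0 < γ) (hγ₁ : γ < 1) :
    ∃ A : ℝ, ∀ {u v : Space → Spinor} {ε : ℝ}, 0 ≤ ε → u ∈ admissible Ω v →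
      (∀ w ∈ admissible Ω v, energy (exterior Ω) m u ≤ energy (exterior Ω) m w + ε) →
      LamTube Ω m (m ^ (-(1 / 2) : ℝ)) v
        ≤ (1 + 16 / (1 - γ) ^ 2 * m⁻¹ * Real.exp (-(γ * Real.sqrt m))) * energy (exterior Ω) m u
          + A * Real.sqrt (ε * energy (exterior Ω) m u) := by
  set δ : ℝ := m ^ (-(1 / 2) : ℝ) with hδ
  have hδ0 : 0 < δ := Real.rpow_pos_of_pos hm _
  have hδs : δ = (Real.sqrt m)⁻¹ := by rw [hδ, Real.rpow_neg hm.le, ← Real.sqrt_eq_rpow]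
  have hsm : 0 < Real.sqrt m := Real.sqrt_pos.2 hm
  have hmδ : m * δ = Real.sqrt m := by
    rw [hδs, ← div_eq_mul_inv, Real.div_sqrt]
  have hγ' : 0 < 1 - γ := sub_pos.2 hγ₁
  have hU := isOpen_exterior Ω
  -- Ending the cutoff at `3δ/4 < δ` meets the outer condition, and its slope is `4/δ = 4√m`.
  have hab : δ / 2 < 3 * δ / 4 := by linarith
  have hθ := isMultiplier_cutoff (Ω := Ω) hab
  obtain ⟨C₁, hC₁, hC₁b⟩ := exists_agmon Ω hm hγ₀ hγ₁ hδ0.le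
  obtain ⟨C₂, hC₂, hC₂b⟩ := exists_energy_smul_le hθ.sq.sub_one hm
  have hq := isMultiplier_weight Ω (m * γ) hδ0.le
  -- `16m` is the squared slope. The exponential is the inverse of `q²` at distance `δ/2`, since
  -- `2mγ · δ/2 = γ√m`.
  set B := 16 * m * Real.exp (-(γ * Real.sqrt m)) with hB
  have hB0 : 0 ≤ B := by positivity
  refine ⟨Real.sqrt C₂ + B * C₁, fun {u v ε} hε hu hmin => ?_⟩
  set E := energy (exterior Ω) m u with hE
  set θ := cutoff Ω (δ / 2) (3 * δ / 4) with hθd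
  have h1 : LamTube Ω m δ v ≤ energy (exterior Ω) m fun x => θ x • u x :=
    (csInf_le (bddBelow_energy _ _ _) ⟨_, cutoff_smul_mem_admissibleTube (by positivity) hab
      (by linarith) hu, rfl⟩).trans (energy_mono (isOpen_tube Ω δ) (tube_subset_exterior Ω δ)
      (hu.1.smul hU hθ) m)
  have h2 : energyForm (exterior Ω) m u (fun x => θ x ^ 2 - 1)
      ≤ Real.sqrt C₂ * Real.sqrt (ε * E) := by
    refine (le_abs_self _).trans ((abs_energyForm_le hu hmin hθ.sq.sub_one fun x hx => ?_).trans ?_)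
    · rw [hθd, cutoff_eq_one hab (by rw [infDist_eq_zero_of_mem hx]; positivity)]
      norm_num
    · rw [← Real.sqrt_mul hC₂]
      refine Real.sqrt_le_sqrt ?_
      have := mul_le_mul_of_nonneg_left (hC₂b hU hu.1) hε
      linarith
  have h3 : ∀ x, ∑ j, partialDeriv j θ x ^ 2 ≤ B * weight Ω (m * γ) δ x ^ 2 := by
    intro x
    refine (sum_sq_partialDeriv_le θ x).trans ?_
    rcases lt_or_ge (Metric.infDist x (frontier Ω)) (δ / 2) with hx | hx
    · rw [hθd, fderiv_cutoff_eq_zero hab hx]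
      rw [norm_zero, zero_pow two_ne_zero]
      positivity
    · have h4 := norm_fderiv_le_of_lipschitz ℝ (lipschitzWith_cutoff (Ω := Ω) hab) (x₀ := x)
      have h5 : ‖fderiv ℝ θ x‖ ^ 2 ≤ 16 * m := by
        refine (pow_le_pow_left₀ (norm_nonneg _) h4 2).trans (le_of_eq ?_)
        change (1 / (3 * δ / 4 - δ / 2)) ^ 2 = 16 * m
        rw [show 3 * δ / 4 - δ / 2 = δ / 4 by ring, hδs]
        field_simp
        rw [Real.sq_sqrt hm.le]
        ring
      have h6 : 1 ≤ Real.exp (-(γ * Real.sqrt m)) * weight Ω (m * γ) δ x ^ 2 := by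
        rw [weight, ← Real.exp_nat_mul, ← Real.exp_add]
        refine Real.one_le_exp ?_
        have h7 : δ / 2 ≤ min (Metric.infDist x (frontier Ω)) δ := le_min hx (by linarith)
        have h8 := mul_le_mul_of_nonneg_left h7 (show 0 ≤ m * γ by positivity)
        rw [← hmδ]
        push_cast
        linarith
      have h9 := mul_le_mul_of_nonneg_left h6 (show 0 ≤ 16 * m by positivity)
      rw [hB]
      linarith
  have hint : Integrable (fun x => weight Ω (m * γ) δ x ^ 2 * ‖u x‖ ^ 2)
      (volume.restrict (exterior Ω)) := by
    refine (integrable_norm_sq (hq.memLp_smul hu.1.1)).congr (Eventually.of_forall fun x => ?_)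
    simp only [norm_smul, mul_pow, Real.norm_eq_abs, sq_abs]
  have h10 : ∫ x in exterior Ω, (∑ j, partialDeriv j θ x ^ 2) * ‖u x‖ ^ 2
      ≤ B * ∫ x in exterior Ω, weight Ω (m * γ) δ x ^ 2 * ‖u x‖ ^ 2 := by
    rw [← integral_const_mul]
    refine integral_mono (integrable_sum_sq_partialDeriv hU hu.1 hθ) (hint.const_mul _) fun x => ?_
    have := mul_le_mul_of_nonneg_right (h3 x) (sq_nonneg ‖u x‖)
    simp only
    linarith
  have h11 := mul_le_mul_of_nonneg_left (hC₁b hε hu hmin) hB0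
  -- The bound `m²‖u‖² ≤ E` converts the factor `m` in `B` into `m⁻¹`.
  have h12 : B * (1 / (1 - γ) ^ 2 * ∫ x in exterior Ω, ‖u x‖ ^ 2)
      ≤ 16 / (1 - γ) ^ 2 * m⁻¹ * Real.exp (-(γ * Real.sqrt m)) * E := by
    have h13 := mul_le_mul_of_nonneg_left (mul_integral_norm_sq_le_energy (exterior Ω) m u)
      (show 0 ≤ 16 / (1 - γ) ^ 2 * m⁻¹ * Real.exp (-(γ * Real.sqrt m)) by positivity)
    refine le_of_eq_of_le ?_ h13
    rw [hB]
    field_simp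
  rw [energy_smul_eq hU hu.1 hθ, energyForm_eq hU hu.1 hθ.sq, ← hE] at h1
  linarith

/-- The energy of the tube problem is at most slightly larger than that of the exterior problem. -/
theorem LamTube_le (hm : 0 < m) (hγ₀ : 0 < γ) (hγ₁ : γ < 1) (v : Space → Spinor) :
    LamTube Ω m (m ^ (-(1 / 2) : ℝ)) v
      ≤ (1 + 16 / (1 - γ) ^ 2 * m⁻¹ * Real.exp (-(γ * Real.sqrt m))) * Lam Ω m v := by
  have hδ0 : 0 < m ^ (-(1 / 2) : ℝ) := Real.rpow_pos_of_pos hm _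
  rcases (admissible Ω v).eq_empty_or_nonempty with h | h
  -- Extension by zero shows that both classes are empty together, and both infima are then 0.
  · have h' : admissibleTube Ω (m ^ (-(1 / 2) : ℝ)) v = ∅ :=
      Set.eq_empty_of_forall_notMem fun u hu => by
        have := indicator_mem_admissible hδ0 hu
        rw [h] at this
        exact this
    rw [Lam, LamTube, h, h', Set.image_empty, Set.image_empty, Real.sInf_empty, mul_zero]
  obtain ⟨A, hA⟩ := exists_LamTube_le Ω hm hγ₀ hγ₁
  set κ := 16 / (1 - γ) ^ 2 * m⁻¹ * Real.exp (-(γ * Real.sqrt m)) with hκ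
  have hκ0 : 0 ≤ κ := by positivity
  have key : ∀ ε : ℝ, 0 < ε → LamTube Ω m (m ^ (-(1 / 2) : ℝ)) v
      ≤ (1 + κ) * (Lam Ω m v + ε) + |A| * Real.sqrt (ε * (Lam Ω m v + ε)) := by
    intro ε hε
    obtain ⟨_, ⟨u, hu, rfl⟩, hlt⟩ := exists_lt_of_csInf_lt (h.image (energy (exterior Ω) m))
      (show sInf (energy (exterior Ω) m '' admissible Ω v) < Lam Ω m v + ε by
        rw [Lam]; linarith)
    have hmin : ∀ w ∈ admissible Ω v, energy (exterior Ω) m u ≤ energy (exterior Ω) m w + ε := by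
      intro w hw
      have : Lam Ω m v ≤ energy (exterior Ω) m w := csInf_le (bddBelow_energy _ _ _) ⟨w, hw, rfl⟩
      linarith
    refine (hA hε.le hu hmin).trans (add_le_add
      (mul_le_mul_of_nonneg_left hlt.le (by linarith)) ?_)
    exact mul_le_mul (le_abs_self A) (Real.sqrt_le_sqrt (mul_le_mul_of_nonneg_left hlt.le hε.le))
      (Real.sqrt_nonneg _) (abs_nonneg A)
  -- `A` is independent of `ε`, so the bound passes to the limit `ε → 0⁺` by continuity.
  have hc : Continuous fun ε : ℝ =>
      (1 + κ) * (Lam Ω m v + ε) + |A| * Real.sqrt (ε * (Lam Ω m v + ε)) := by fun_prop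
  have hlim := (hc.tendsto 0).mono_left (nhdsWithin_le_nhds (s := Set.Ioi (0 : ℝ)))
  have := ge_of_tendsto hlim (eventually_nhdsWithin_of_forall fun ε hε => key ε hε)
  simpa using this

end Main

end MITBag

end

/-! ### Conclusion. -/

theorem proposition2p4 (Ω : Set MITBag.Space) (hopen : IsOpen Ω) (hne : Ω.Nonempty)
    (hbdd : Bornology.IsBounded Ω) (hreg : MITBag.HasC4Boundary Ω)
    (γ : ℝ) (hγ₀ : 0 < γ) (hγ₁ : γ < 1) :
    ∃ δ₀ C₁ C₂ : ℝ, 0 < δ₀ ∧ 0 < C₁ ∧ 0 < C₂ ∧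
      ∀ δ : ℝ, 0 < δ → δ < δ₀ → ∀ m : ℝ, 0 < m →
      ∀ v : MITBag.Space → MITBag.Spinor, MITBag.MemH1 Ω v →
        (∀ u : MITBag.Space → MITBag.Spinor, MITBag.IsMinimizer Ω m v u →
          (∫⁻ x in MITBag.exterior Ω,
              ‖Real.exp (m * γ * Metric.infDist x (frontier Ω)) • u x‖ₑ ^ 2)
            ≤ ENNReal.ofReal C₁ * ∫⁻ x in MITBag.exterior Ω, ‖u x‖ₑ ^ 2) ∧
        (1 - C₂ * m⁻¹ * Real.exp (-(γ * Real.sqrt m))) *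
            MITBag.LamTube Ω m (m ^ (-(1 / 2) : ℝ)) v ≤ MITBag.Lam Ω m v ∧
        MITBag.Lam Ω m v ≤ MITBag.LamTube Ω m δ v := by
  have hγ' : 0 < 1 - γ := sub_pos.2 hγ₁
  refine ⟨1, 1 / (1 - γ) ^ 2, 16 / (1 - γ) ^ 2, one_pos, by positivity, by positivity, ?_⟩
  intro δ hδ _ m hm v _
  refine ⟨fun u hu => MITBag.lintegral_exp_smul_le hm hγ₀ hγ₁ hu, ?_,
    MITBag.Lam_le_LamTube hδ m v⟩
  have h1 := MITBag.LamTube_le (Ω := Ω) hm hγ₀ hγ₁ v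
  have h2 := MITBag.Lam_nonneg Ω m v
  have h3 := MITBag.LamTube_nonneg Ω m (m ^ (-(1 / 2) : ℝ)) v
  set κ := 16 / (1 - γ) ^ 2 * m⁻¹ * Real.exp (-(γ * Real.sqrt m)) with hκ
  have hκ0 : 0 ≤ κ := by positivity
  -- For `κ ≤ 1` one uses `(1-κ)(1+κ) ≤ 1`; for `κ ≥ 1` the left side is nonpositive.
  rcases le_total κ 1 with h | h
  · have h4 := mul_le_mul_of_nonneg_left h1 (sub_nonneg.2 h)
    have h5 : (1 - κ) * ((1 + κ) * MITBag.Lam Ω m v) ≤ MITBag.Lam Ω m v := by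
      nlinarith [mul_nonneg (sq_nonneg κ) h2]
    exact h4.trans h5
  · exact (mul_nonpos_of_nonpos_of_nonneg (sub_nonpos.2 h) h3).trans h2
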